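/- Conventions. Fix a natural number $d$; all Hilbert spaces are complex. $\Gamma=\bigoplus_{n\ge 0}(\mathbb C^d)^{\otimes n}$ is the full Fock space with orthonormal basis $e_\alpha$ ($\alpha$ a word in $\{1,\dots,d\}$) and left creation operators $L_j$. A row contraction $\underline T=(T_1,\dots,T_d)$ on $\mathcal H_T$ is a $d$-tuple of bounded operators with $\|\sum_j T_j\xi_j\|^2\le\sum_j\|\xi_j\|^2$; $T_\alpha=T_{\alpha_1}\cdots T_{\alpha_m}$. Put $D_T=(\delta_{ij}I-T_i^*T_j)^{1/2}$ on $\bigoplus_1^d\mathcal H_T$, $D_{*,T}=(I-\sum_jT_jT_j^*)^{1/2}$ on $\mathcal H_T$, and let $\mathcal D_T$, $\mathcal D_{*,T}$ be the closures of the ranges of $D_T$, $D_{*,T}$; the defect of $\underline T$ is $\dim\mathcal D_T$. $\underline T$ is completely non-coisometric if $\sum_{|\alpha|=n}\|T_\alpha^*z\|^2=\|z\|^2$ for all $n$ only for $z=0$. Row contractions $\underline T,\underline T'$ are unitarily equivalent if $uT_j=T_j'u$ for all $j$, for some unitary $u:\mathcal H_T\to\mathcal H_{T'}$. An isometric dilation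 of $\underline T$ is a tuple $\underline V$ of isometries with pairwise orthogonal ranges on a Hilbert space $\mathcal K\supset\mathcal H_T$ with $T_\alpha=P_{\mathcal H_T}V_\alpha|_{\mathcal H_T}$ for all words $\alpha$. The minimal isometric dilation $\underline V^T$ lives on $\mathcal H_T\oplus(\Gamma\otimes\mathcal D_T)$ and is $V^T_j(h\oplus f)=T_jh\oplus\big(e_\emptyset\otimes D_T(0,\dots,h,\dots,0)+(L_j\otimes I)f\big)$ ($h$ in position $j$). For an isometric dilation $\underline V$ of $\underline T$ put $\mathcal L_T=\overline{\mathrm{span}}\{\mathcal H_T,V_1\mathcal H_T,\dots,V_d\mathcal H_T\}\ominus\mathcal H_T$, and let $\mathcal L_{*,T}=\mathcal K_0\ominus\overline{\mathrm{span}}\{V_j\mathcal K_0: 1\le j\le d\}$, where $\mathcal K_0$ is the smallest closed $\underline V$-invariant subspace containing $\mathcal H_T$. There are canonical unitaries $\mathcal D_T\to\mathcal L_T$, $D_T(\xi_j)_j\mapsto\sum_j(V_j-T_j)\xi_j$, and $\mathcal D_{*,T}\to\mathcal L_{*,T}$, $D_{*,T}\xi\mapsto(I-\sum_jV_jT_j^*)\xi$.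 The spaces $V_\alpha\mathcal L_T$ are pairwise orthogonal, and so are the spaces $V_\alpha\mathcal L_{*,T}$; thus $\bigoplus_\alpha V_\alpha\mathcal L_T\cong\Gamma\otimes\mathcal D_T$ and $\bigoplus_\alpha V_\alpha\mathcal L_{*,T}\cong\Gamma\otimes\mathcal D_{*,T}$. The characteristic function $M_{\Theta_T}:\Gamma\otimes\mathcal D_T\to\Gamma\otimes\mathcal D_{*,T}$ (Popescu) is, for $\underline V=\underline V^T$, the orthogonal projection onto $\bigoplus_\alpha V_\alpha\mathcal L_{*,T}$ restricted to $\bigoplus_\alpha V_\alpha\mathcal L_T$. A contractive lifting of a row contraction $\underline C$ on $\mathcal H_C$ is a row contraction $\underline E$ on $\mathcal H_E=\mathcal H_C\oplus\mathcal H_A$ of the form $E_j=\begin{pmatrix}C_j&0\\B_j&A_j\end{pmatrix}$; it is minimal if the vectors $E_\alpha x$ ($x\in\mathcal H_C$, $\alpha$ a word) span a dense subspace of $\mathcal H_E$. Then $\underline V^E$ is an isometric dilation of $\underline E$, of $\underline C$ and of $\underline A$, and $\mathcal L_E,\mathcal L_C,\mathcal L_A,\mathcal L_{*,A}$ denote the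 corresponding subspaces formed with $\underline V=\underline V^E$. The characteristic function $M_{C,E}:\Gamma\otimes\mathcal D_E\to\Gamma\otimes\mathcal D_C$ of the lifting is the orthogonal projection onto $\bigoplus_\alpha V^E_\alpha\mathcal L_C$ restricted to $\bigoplus_\alpha V^E_\alpha\mathcal L_E$. For a contraction $M:\Gamma\otimes\mathcal D\to\Gamma\otimes\mathcal L$ let $\Theta(\delta)=M(e_\emptyset\otimes\delta)$ be its symbol. $M$ is purely contractive if $\|P_{e_\emptyset\otimes\mathcal L}\Theta(\delta)\|<\|\delta\|$ for all $\delta\ne0$. It satisfies the Szegő condition if $\overline{\Delta(\Gamma\otimes\mathcal D)}=\overline{\Delta\big((\Gamma\otimes\mathcal D)\ominus(e_\emptyset\otimes\mathcal D)\big)}$, where $\Delta=(I-M^*M)^{1/2}$. $M$ and $M':\Gamma\otimes\mathcal D'\to\Gamma\otimes\mathcal L'$ coincide if there are unitaries $v:\mathcal D\to\mathcal D'$, $v':\mathcal L\to\mathcal L'$ with $\Theta'\circ v=(I\otimes v')\circ\Theta$. Theorem. (1) Let $\underline E$ be a minimal contractive lifting of a row contraction $\underline C$, with lower right corner $\underline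 A$. Then $M_{C,E}$ is purely contractive and satisfies the Szegő condition if and only if $\mathcal L_E=\mathcal L_A$ and $\mathcal L_C=\mathcal L_{*,A}$. In this case $M_{C,E}=M_{\Theta_A}$ with the canonical identifications $\mathcal D_E\cong\mathcal L_E=\mathcal L_A\cong\mathcal D_A$ and $\mathcal D_C\cong\mathcal L_C=\mathcal L_{*,A}\cong\mathcal D_{*,A}$. (2) Let $\underline A$ be a completely non-coisometric row contraction and let $\underline C$ be any row contraction with defect $\dim\mathcal D_C=\dim\mathcal D_{*,A}$. Then there is a minimal contractive lifting $\underline E$ of $\underline C$ with lower right corner $\underline A$ such that $\mathcal L_E=\mathcal L_A$, $\mathcal L_C=\mathcal L_{*,A}$, and $M_{C,E}=M_{\Theta_A}$ with the identifications of (1). (3) For completely non-coisometric row contractions $\underline A$ and $\underline A'$ (with the same $d$), the characteristic functions $M_{\Theta_A}$ and $M_{\Theta_{A'}}$ coincide if and only if $\underline A$ and $\underline A'$ are unitarily equivalent. -/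

import Mathlib

noncomputable section

namespace RowLift

universe u v w

set_option linter.unusedSectionVars false

/-! ## Defect operators -/

section Defect

variable {X : Type u} {Y : Type v} {K : Type w}
  [NormedAddCommGroup X] [InnerProductSpace ℂ X] [CompleteSpace X]
  [NormedAddCommGroup Y] [InnerProductSpace ℂ Y] [CompleteSpace Y]
  [NormedAddCommGroup K] [InnerProductSpace ℂ K] [CompleteSpace K]

/-- The defect operator `(1 - S* S)^{1/2}` of a contraction `S` between Hilbert spaces. -/
def defectOp (S : X →L[ℂ] Y) : X →L[ℂ] X :=
  CFC.sqrt (1 - (ContinuousLinearMap.adjoint S).comp S)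

/-- The defect space of `S`: the closure of the range of the defect operator. -/
abbrev defectSpace (S : X →L[ℂ] Y) : Submodule ℂ X :=
  (LinearMap.range (defectOp S : X →ₗ[ℂ] X)).topologicalClosure

theorem adjoint_defectOp (S : X →L[ℂ] Y) :
    ContinuousLinearMap.adjoint (defectOp S) = defectOp S :=
  (CFC.sqrt_nonneg (1 - (ContinuousLinearMap.adjoint S).comp S)).isSelfAdjoint

theorem defectOp_mul_self (S : X →L[ℂ] Y) (hS : ∀ x, ‖S x‖ ≤ ‖x‖) :
    defectOp S * defectOp S = 1 - (ContinuousLinearMap.adjoint S).comp S := by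
  refine CFC.sqrt_mul_sqrt_self _ ?_
  rw [ContinuousLinearMap.nonneg_iff_isPositive, ContinuousLinearMap.isPositive_iff_complex]
  intro x
  have h : inner ℂ ((1 - (ContinuousLinearMap.adjoint S).comp S) x) x
      = ((‖x‖ ^ 2 - ‖S x‖ ^ 2 : ℝ) : ℂ) := by
    simp [ContinuousLinearMap.adjoint_inner_left, inner_self_eq_norm_sq_to_K]
  rw [h]
  refine ⟨by simp only [RCLike.re_eq_complex_re, Complex.ofReal_re], ?_⟩
  have := hS x
  have h2 : ‖S x‖ ^ 2 ≤ ‖x‖ ^ 2 := by gcongr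
  simpa only [RCLike.re_eq_complex_re, Complex.ofReal_re] using sub_nonneg.2 h2

theorem norm_defectOp_sq (S : X →L[ℂ] Y) (hS : ∀ x, ‖S x‖ ≤ ‖x‖) (x : X) :
    ‖defectOp S x‖ ^ 2 = ‖x‖ ^ 2 - ‖S x‖ ^ 2 := by
  have key : inner ℂ (defectOp S x) (defectOp S x)
      = inner ℂ ((1 - (ContinuousLinearMap.adjoint S).comp S) x) x := by
    rw [← defectOp_mul_self S hS, ← ContinuousLinearMap.adjoint_inner_left, adjoint_defectOp]
    rfl
  have h : inner ℂ ((1 - (ContinuousLinearMap.adjoint S).comp S) x) x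
        = ((‖x‖ ^ 2 - ‖S x‖ ^ 2 : ℝ) : ℂ) := by
    simp [ContinuousLinearMap.adjoint_inner_left, inner_self_eq_norm_sq_to_K]
  rw [h, inner_self_eq_norm_sq_to_K] at key
  have key' : ((‖defectOp S x‖ ^ 2 : ℝ) : ℂ) = ((‖x‖ ^ 2 - ‖S x‖ ^ 2 : ℝ) : ℂ) := by
    rw [← key]; push_cast; rfl
  exact Complex.ofReal_injective key'

/-- The canonical map of `X` onto a dense subspace of the defect space, `x ↦ D_S x`. -/
def toDefect (S : X →L[ℂ] Y) : X →L[ℂ] defectSpace S :=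
  (defectOp S).codRestrict _ fun x => Submodule.le_topologicalClosure _ ⟨x, rfl⟩

theorem denseRange_toDefect (S : X →L[ℂ] Y) : DenseRange (toDefect S) := by
  intro y
  rw [closure_subtype]
  have h : (Subtype.val '' Set.range (toDefect S)) = (LinearMap.range (defectOp S : X →ₗ[ℂ] X) : Set X) := by
    rw [← Set.range_comp]; rfl
  rw [h]
  exact y.2

theorem inner_toDefect (S : X →L[ℂ] Y) (hS : ∀ x, ‖S x‖ ≤ ‖x‖) (x y : X) :
    inner ℂ (toDefect S x) (toDefect S y) = inner ℂ x y - inner ℂ (S x) (S y) := by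
  change inner ℂ (defectOp S x) (defectOp S y) = _
  rw [← ContinuousLinearMap.adjoint_inner_left, adjoint_defectOp]
  change inner ℂ ((defectOp S * defectOp S) x) y = _
  rw [defectOp_mul_self S hS]
  simp [ContinuousLinearMap.adjoint_inner_left]

/-- If `‖u x‖ = ‖D_S x‖` for all `x` then `D_S x ↦ u x` extends to an isometry on the defect
space of `S`. -/
def defectLift (S : X →L[ℂ] Y) (u : X →L[ℂ] K) (h : ∀ x, ‖u x‖ = ‖defectOp S x‖) :
    defectSpace S →ₗᵢ[ℂ] K where
  toLinearMap := ((u : X →ₗ[ℂ] K).extendOfNorm (toDefect S : X →ₗ[ℂ] defectSpace S) :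
    defectSpace S →L[ℂ] K)
  norm_map' := by
    have hd : DenseRange (toDefect S : X →ₗ[ℂ] defectSpace S) := denseRange_toDefect S
    have hn : ∀ x, ‖(u : X →ₗ[ℂ] K) x‖ ≤ 1 * ‖(toDefect S : X →ₗ[ℂ] defectSpace S) x‖ := by
      intro x; rw [one_mul]; exact (h x).le
    intro x
    refine hd.induction (P := fun x => ‖((u : X →ₗ[ℂ] K).extendOfNorm
      (toDefect S : X →ₗ[ℂ] defectSpace S)) x‖ = ‖x‖) ?_
      (isClosed_eq (by fun_prop) (by fun_prop)) x
    rintro _ ⟨y, rfl⟩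
    rw [LinearMap.extendOfNorm_eq hd ⟨1, hn⟩]
    exact h y

theorem defectLift_apply (S : X →L[ℂ] Y) (u : X →L[ℂ] K) (h : ∀ x, ‖u x‖ = ‖defectOp S x‖)
    (x : X) : defectLift S u h (toDefect S x) = u x :=
  LinearMap.extendOfNorm_eq (e := (toDefect S : X →ₗ[ℂ] defectSpace S))
    (denseRange_toDefect S) ⟨1, fun x => by rw [one_mul]; exact (h x).le⟩ x

/-- The Hilbert space dimension: the cardinality of an orthonormal basis. -/
def hilbertDim (X : Type u) [NormedAddCommGroup X] [InnerProductSpace ℂ X] : Cardinal.{u} :=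
  sInf {κ | ∃ (s : Set X) (_ : HilbertBasis s ℂ X), κ = Cardinal.mk s}

/-- `X` and `Y` (in possibly different universes) have the same Hilbert space dimension. -/
def SameHilbertDim (X : Type u) (Y : Type v) [NormedAddCommGroup X] [InnerProductSpace ℂ X]
    [NormedAddCommGroup Y] [InnerProductSpace ℂ Y] : Prop :=
  Cardinal.lift.{v} (hilbertDim X) = Cardinal.lift.{u} (hilbertDim Y)

end Defect

/-! ## The full Fock space with coefficients -/

section Fock

/-- The Hilbert space `Γ ⊗ D`, where `Γ` is the full Fock space over `ℂ^d`. Words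
`α = α₁ … α_m` in `{1, …, d}` index the orthonormal basis `e_α = e_{α₁} ⊗ … ⊗ e_{α_m}` of `Γ`, so
that `Γ ⊗ D` is the Hilbert space of square summable families `(f_α)` in `D`; such a family
stands for `∑_α e_α ⊗ f_α`. -/
abbrev Fock (d : ℕ) (D : Type u) [NormedAddCommGroup D] [InnerProductSpace ℂ D] : Type u :=
  lp (fun _ : List (Fin d) => D) 2

variable {d : ℕ} {D : Type u} {D' : Type v} {L : Type w}
  [NormedAddCommGroup D] [InnerProductSpace ℂ D]
  [NormedAddCommGroup D'] [InnerProductSpace ℂ D']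
  [NormedAddCommGroup L] [InnerProductSpace ℂ L]

/-- The isometry `δ ↦ e_α ⊗ δ`. -/
def Fock.ket (α : List (Fin d)) : D →ₗᵢ[ℂ] Fock d D where
  toLinearMap := lp.lsingle (𝕜 := ℂ) (E := fun _ : List (Fin d) => D) 2 α
  norm_map' := fun x => lp.norm_single (E := fun _ : List (Fin d) => D) (p := 2) two_pos α x

theorem Fock.inner_ket_of_ne {α β : List (Fin d)} (h : α ≠ β) (x y : D) :
    inner ℂ (Fock.ket α x) (Fock.ket β y) = 0 := by
  change inner ℂ (lp.single 2 α x : Fock d D) (lp.single 2 β y) = 0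
  rw [lp.inner_single_left]
  exact (congrArg (inner ℂ x)
    (lp.single_apply_ne (E := fun _ : List (Fin d) => D) 2 β y h)).trans (inner_zero_right x)

theorem Fock.orthogonalFamily_cons (j : Fin d) :
    OrthogonalFamily ℂ (fun _ : List (Fin d) => D)
      (fun α => (Fock.ket (j :: α) : D →ₗᵢ[ℂ] Fock d D)) := by
  intro α β h x y
  exact Fock.inner_ket_of_ne (fun h' => h (List.cons.inj h').2) x y

/-- The creation operator `L_j ⊗ I` on `Γ ⊗ D`, the isometry with
`e_α ⊗ δ ↦ e_j ⊗ e_α ⊗ δ`. -/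
def Fock.creation [CompleteSpace D] (j : Fin d) : Fock d D →ₗᵢ[ℂ] Fock d D :=
  (Fock.orthogonalFamily_cons j).linearIsometry

theorem Fock.creation_ket [CompleteSpace D] (j : Fin d) (α : List (Fin d)) (δ : D) :
    Fock.creation j (Fock.ket α δ) = Fock.ket (j :: α) δ :=
  (Fock.orthogonalFamily_cons (D := D) j).linearIsometry_apply_single δ

theorem Fock.orthogonalFamily_comp (v : D →ₗᵢ[ℂ] D') :
    OrthogonalFamily ℂ (fun _ : List (Fin d) => D)
      (fun α => ((Fock.ket α : D' →ₗᵢ[ℂ] Fock d D').comp v)) := by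
  intro α β h x y
  exact Fock.inner_ket_of_ne h _ _

/-- The operator `I ⊗ v : Γ ⊗ D → Γ ⊗ D'` for an isometry `v : D → D'`. -/
def Fock.ampliation [CompleteSpace D'] (v : D →ₗᵢ[ℂ] D') : Fock d D →ₗᵢ[ℂ] Fock d D' :=
  (Fock.orthogonalFamily_comp v).linearIsometry

theorem Fock.ampliation_ket [CompleteSpace D'] (v : D →ₗᵢ[ℂ] D') (α : List (Fin d)) (δ : D) :
    Fock.ampliation v (Fock.ket α δ) = Fock.ket α (v δ) :=
  (Fock.orthogonalFamily_comp (d := d) v).linearIsometry_apply_single δ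

/-- The subspace `e_∅ ⊗ D` of `Γ ⊗ D`. -/
def Fock.vacuum (d : ℕ) (D : Type u) [NormedAddCommGroup D] [InnerProductSpace ℂ D] :
    Submodule ℂ (Fock d D) :=
  LinearMap.range (Fock.ket (d := d) (D := D) []).toLinearMap

/-- The symbol `Θ(δ) = M (e_∅ ⊗ δ)` of an operator `M : Γ ⊗ D → Γ ⊗ L`. -/
def symbol (M : Fock d D →L[ℂ] Fock d L) (δ : D) : Fock d L := M (Fock.ket [] δ)

/-- `M` is purely contractive: `‖P_{e_∅ ⊗ L} Θ(δ)‖ < ‖δ‖` for all `δ ≠ 0`. The vector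
`P_{e_∅ ⊗ L} Θ(δ)` is `e_∅ ⊗ ℓ`, with `ℓ` the coefficient of `Θ(δ)` at the empty word. -/
def IsPurelyContractive (M : Fock d D →L[ℂ] Fock d L) : Prop :=
  ∀ δ : D, δ ≠ 0 → ‖Fock.ket (d := d) [] (symbol M δ [])‖ < ‖δ‖

/-- The Szegő condition: with `Δ = (1 - M* M)^{1/2}`, the spaces `Δ(Γ ⊗ D)` and
`Δ((Γ ⊗ D) ⊖ (e_∅ ⊗ D))` have the same closure. -/
def SzegoCondition [CompleteSpace D] [CompleteSpace L] (M : Fock d D →L[ℂ] Fock d L) : Prop :=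
  (LinearMap.range (defectOp M : Fock d D →ₗ[ℂ] Fock d D)).topologicalClosure =
    ((Fock.vacuum d D)ᗮ.map (defectOp M : Fock d D →ₗ[ℂ] Fock d D)).topologicalClosure

/-- `M` and `M'` coincide: there are unitaries `v : D → D'` and `v' : L → L'` with
`Θ' ∘ v = (I ⊗ v') ∘ Θ`. -/
def Coincide {L' : Type*} [NormedAddCommGroup L'] [InnerProductSpace ℂ L'] [CompleteSpace L']
    (M : Fock d D →L[ℂ] Fock d L) (M' : Fock d D' →L[ℂ] Fock d L') : Prop :=
  ∃ (v : D ≃ₗᵢ[ℂ] D') (v' : L ≃ₗᵢ[ℂ] L'),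
    ∀ δ : D, symbol M' (v δ) = Fock.ampliation v'.toLinearIsometry (symbol M δ)

end Fock

/-! ## Row contractions -/

section Row

/-- The operator `T_α = T_{α₁} ⋯ T_{α_m}` for a word `α = α₁ … α_m`. -/
def wordOp {d : ℕ} {H : Type u} [NormedAddCommGroup H] [InnerProductSpace ℂ H]
    (T : Fin d → H →L[ℂ] H) (α : List (Fin d)) : H →L[ℂ] H :=
  (α.map T).prod

/-- The direct sum of `d` copies of `H`. -/
abbrev Copies (d : ℕ) (H : Type u) [NormedAddCommGroup H] [InnerProductSpace ℂ H] : Type u :=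
  PiLp 2 (fun _ : Fin d => H)

/-- The operator `(x_1, …, x_d) ↦ ∑_j T_j x_j`. -/
def rowOp {d : ℕ} {H : Type u} {K : Type v} [NormedAddCommGroup H] [InnerProductSpace ℂ H]
    [NormedAddCommGroup K] [InnerProductSpace ℂ K]
    (T : Fin d → H →L[ℂ] K) : Copies d H →L[ℂ] K :=
  ∑ j, (T j).comp (PiLp.proj 2 (fun _ : Fin d => H) j)

/-- The `j`-th coordinate embedding of `H` into the direct sum of `d` copies of `H`. -/
def coord {d : ℕ} {H : Type u} [NormedAddCommGroup H] [InnerProductSpace ℂ H] (j : Fin d) :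
    H →ₗᵢ[ℂ] Copies d H where
  toFun x := PiLp.single 2 j x
  map_add' x y := by ext i; by_cases h : i = j <;> simp [h]
  map_smul' c x := by ext i; by_cases h : i = j <;> simp [h]
  norm_map' x := PiLp.norm_single 2 (fun _ : Fin d => H) j x

/-- A row contraction: a `d`-tuple of bounded operators on `H` which is a contraction from the
direct sum of `d` copies of `H` to `H`. -/
structure RowContraction (d : ℕ) (H : Type u) [NormedAddCommGroup H] [InnerProductSpace ℂ H] where
  op : Fin d → H →L[ℂ] H
  contractive : ∀ x, ‖rowOp op x‖ ≤ ‖x‖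

end Row

/-! ## Wandering subspaces of a row isometry -/

section Wandering

variable {d : ℕ} {D : Type u} {K : Type v} [NormedAddCommGroup D] [InnerProductSpace ℂ D]
  [NormedAddCommGroup K] [InnerProductSpace ℂ K]

/-- `V` is a row isometry: the `V_j` are isometries with pairwise orthogonal ranges. -/
def IsRowIsometry (V : Fin d → K →L[ℂ] K) : Prop :=
  ∀ i j x y, inner ℂ (V i x) (V j y) = if i = j then inner ℂ x y else 0

theorem inner_wordOp_self {V : Fin d → K →L[ℂ] K} (hV : IsRowIsometry V) (α : List (Fin d))
    (x y : K) : inner ℂ (wordOp V α x) (wordOp V α y) = inner ℂ x y := by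
  induction α with
  | nil => simp [wordOp]
  | cons i α ih =>
    have := hV i i (wordOp V α x) (wordOp V α y)
    rw [if_pos rfl, ih] at this
    simpa [wordOp] using this

/-- For an isometry `ι` with wandering range, the isometry `δ ↦ V_α ι δ`. -/
def translate {V : Fin d → K →L[ℂ] K} (hV : IsRowIsometry V) (ι : D →ₗᵢ[ℂ] K)
    (α : List (Fin d)) : D →ₗᵢ[ℂ] K :=
  ((wordOp V α : K →ₗ[ℂ] K).isometryOfInner (inner_wordOp_self hV α)).comp ι

theorem orthogonalFamily_translate {V : Fin d → K →L[ℂ] K} (hV : IsRowIsometry V)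
    (ι : D →ₗᵢ[ℂ] K)
    (hw : ∀ j α x y, inner ℂ (ι x) (V j (wordOp V α (ι y))) = 0) :
    OrthogonalFamily ℂ (fun _ : List (Fin d) => D) (translate hV ι) := by
  have key : ∀ (α β : List (Fin d)), α ≠ β → ∀ x y,
      inner ℂ (wordOp V α (ι x)) (wordOp V β (ι y)) = 0 := by
    intro α
    induction α with
    | nil =>
      intro β h x y
      cases β with
      | nil => exact absurd rfl h
      | cons j β => simpa [wordOp] using hw j β x y
    | cons i α ih =>
      intro β h x y
      cases β with
      | nil =>
        rw [← inner_conj_symm]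
        simpa [wordOp] using congrArg (starRingEnd ℂ) (hw i α y x)
      | cons j β =>
        have := hV i j (wordOp V α (ι x)) (wordOp V β (ι y))
        by_cases hij : i = j
        · subst hij
          rw [if_pos rfl, ih β (fun h' => h (by rw [h'])) x y] at this
          simpa [wordOp] using this
        · rw [if_neg hij] at this
          simpa [wordOp] using this
  intro α β h x y
  exact key α β h x y

/-- If the range of the isometry `ι : D → K` is wandering for the row isometry `V`, then
`e_α ⊗ δ ↦ V_α ι δ` defines an isometry `Γ ⊗ D → K`. -/
def shiftEmb [CompleteSpace K] {V : Fin d → K →L[ℂ] K} (hV : IsRowIsometry V) (ι : D →ₗᵢ[ℂ] K)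
    (hw : ∀ j α x y, inner ℂ (ι x) (V j (wordOp V α (ι y))) = 0) : Fock d D →ₗᵢ[ℂ] K :=
  (orthogonalFamily_translate hV ι hw).linearIsometry

theorem shiftEmb_ket [CompleteSpace K] {V : Fin d → K →L[ℂ] K} (hV : IsRowIsometry V)
    (ι : D →ₗᵢ[ℂ] K) (hw : ∀ j α x y, inner ℂ (ι x) (V j (wordOp V α (ι y))) = 0)
    (α : List (Fin d)) (δ : D) : shiftEmb hV ι hw (Fock.ket α δ) = wordOp V α (ι δ) :=
  (orthogonalFamily_translate hV ι hw).linearIsometry_apply_single δ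

/-- For a subspace `S`, the space `span {S, V (S ⊕ ⋯ ⊕ S)} ⊖ S` (closed span). -/
def wandering (V : Fin d → K →L[ℂ] K) (S : Submodule ℂ K) : Submodule ℂ K :=
  (S ⊔ ⨆ j, S.map (V j : K →ₗ[ℂ] K)).topologicalClosure ⊓ Sᗮ

/-- The smallest closed `V`-invariant subspace containing `S`. -/
def invariantHull (V : Fin d → K →L[ℂ] K) (S : Submodule ℂ K) : Submodule ℂ K :=
  (⨆ α, S.map (wordOp V α : K →ₗ[ℂ] K)).topologicalClosure

/-- With `K₀` the smallest closed `V`-invariant subspace containing `S`, the kernel of the adjoint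
of the row operator `V|_{K₀} : K₀ ⊕ ⋯ ⊕ K₀ → K₀`, that is `K₀ ⊖ V (K₀ ⊕ ⋯ ⊕ K₀)`. -/
def starWandering (V : Fin d → K →L[ℂ] K) (S : Submodule ℂ K) : Submodule ℂ K :=
  invariantHull V S ⊓ (⨆ j, (invariantHull V S).map (V j : K →ₗ[ℂ] K))ᗮ

end Wandering

section Dilation

variable {d : ℕ} {H : Type u} {K : Type v}
  [NormedAddCommGroup H] [InnerProductSpace ℂ H] [CompleteSpace H]
  [NormedAddCommGroup K] [InnerProductSpace ℂ K] [CompleteSpace K]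

namespace RowContraction

/-- The defect space `D_T`, the closure of the range of `(δ_{ij} - T_i* T_j)^{1/2}`. -/
abbrev defect (T : RowContraction d H) : Submodule ℂ (Copies d H) := defectSpace (rowOp T.op)

/-- The `*`-defect space `D_{*,T}`, the closure of the range of `(1 - ∑ T_j T_j*)^{1/2}`. -/
abbrev starDefect (T : RowContraction d H) : Submodule ℂ H :=
  defectSpace (ContinuousLinearMap.adjoint (rowOp T.op))

/-- `T` is completely non-coisometric: only `z = 0` satisfies
`∑_{|α| = n} ‖T_α* z‖² = ‖z‖²` for all `n`. -/
def IsCNC (T : RowContraction d H) : Prop :=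
  ∀ z : H, (∀ n : ℕ, ∑ α : Fin n → Fin d,
    ‖ContinuousLinearMap.adjoint (wordOp T.op (List.ofFn α)) z‖ ^ 2 = ‖z‖ ^ 2) → z = 0

/-- Unitary equivalence of row contractions. -/
def UnitarilyEquivalent {H' : Type*} [NormedAddCommGroup H'] [InnerProductSpace ℂ H']
    (T : RowContraction d H) (T' : RowContraction d H') : Prop :=
  ∃ u : H ≃ₗᵢ[ℂ] H', ∀ j x, u (T.op j x) = T'.op j (u x)

end RowContraction

/-! ## Isometric dilations -/

/-- An isometric dilation of `T` on `K ⊇ H` (the inclusion is the isometry `emb`): a row isometry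
`V` (isometries with orthogonal ranges) with `T_α = P_H V_α |_H` for all words `α`. -/
structure IsometricDilation (T : RowContraction d H) (K : Type v)
    [NormedAddCommGroup K] [InnerProductSpace ℂ K] where
  V : Fin d → K →L[ℂ] K
  emb : H →ₗᵢ[ℂ] K
  isRowIsometry : IsRowIsometry V
  dilation : ∀ α h h', inner ℂ (emb h') (wordOp V α (emb h)) = inner ℂ h' (wordOp T.op α h)

namespace IsometricDilation

variable {T : RowContraction d H} (𝒟 : IsometricDilation T K)

theorem inner_V_emb (j : Fin d) (h h' : H) :
    inner ℂ (𝒟.emb h') (𝒟.V j (𝒟.emb h)) = inner ℂ h' (T.op j h) := by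
  simpa [wordOp] using 𝒟.dilation [j] h h'

/-- The operator `ξ ↦ ∑_j (V_j - T_j) ξ_j` on the direct sum of `d` copies of `H`. -/
def defectMap : Copies d H →L[ℂ] K :=
  rowOp (fun j => (𝒟.V j).comp 𝒟.emb.toContinuousLinearMap)
    - 𝒟.emb.toContinuousLinearMap.comp (rowOp T.op)

/-- The operator `ξ ↦ (1 - ∑_j V_j T_j*) ξ` on `H`. -/
def starMap : H →L[ℂ] K :=
  𝒟.emb.toContinuousLinearMap
    - ∑ j, (𝒟.V j).comp (𝒟.emb.toContinuousLinearMap.comp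
        (ContinuousLinearMap.adjoint (T.op j)))

theorem norm_sum_V_emb (y : Copies d H) : ‖∑ j, 𝒟.V j (𝒟.emb (y j))‖ ^ 2 = ‖y‖ ^ 2 := by
  have h : inner ℂ (∑ j, 𝒟.V j (𝒟.emb (y j))) (∑ j, 𝒟.V j (𝒟.emb (y j))) = inner ℂ y y := by
    simp only [sum_inner, inner_sum, 𝒟.isRowIsometry _ _, LinearIsometry.inner_map_map,
      PiLp.inner_apply, Finset.sum_ite_eq', Finset.mem_univ, if_true]
  rw [← inner_self_eq_norm_sq (𝕜 := ℂ), h, inner_self_eq_norm_sq]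

theorem norm_defectMap (x : Copies d H) :
    ‖𝒟.defectMap x‖ = ‖defectOp (rowOp T.op) x‖ := by
  have h1 : ‖rowOp (fun j => (𝒟.V j).comp 𝒟.emb.toContinuousLinearMap) x‖ ^ 2 = ‖x‖ ^ 2 := by
    rw [← 𝒟.norm_sum_V_emb x]
    simp [rowOp]
  have h2 : inner ℂ (𝒟.emb (rowOp T.op x))
      (rowOp (fun j => (𝒟.V j).comp 𝒟.emb.toContinuousLinearMap) x)
      = inner ℂ (rowOp T.op x) (rowOp T.op x) := by
    have : ∀ z : H, inner ℂ (𝒟.emb z)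
        (rowOp (fun j => (𝒟.V j).comp 𝒟.emb.toContinuousLinearMap) x)
        = inner ℂ z (rowOp T.op x) := by
      intro z
      simp [rowOp, 𝒟.inner_V_emb]
    exact this _
  rw [← sq_eq_sq₀ (norm_nonneg _) (norm_nonneg _), norm_defectOp_sq _ T.contractive]
  have h3 : ‖𝒟.defectMap x‖ ^ 2
      = ‖rowOp (fun j => (𝒟.V j).comp 𝒟.emb.toContinuousLinearMap) x
          - 𝒟.emb (rowOp T.op x)‖ ^ 2 := rfl
  rw [h3, norm_sub_rev, @norm_sub_sq ℂ, h1, h2, 𝒟.emb.norm_map, inner_self_eq_norm_sq]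
  ring

theorem adjoint_rowOp (x : H) (j : Fin d) :
    (ContinuousLinearMap.adjoint (rowOp T.op) x) j = ContinuousLinearMap.adjoint (T.op j) x := by
  refine ext_inner_left ℂ fun y => ?_
  have h : inner ℂ (coord j y : Copies d H) (ContinuousLinearMap.adjoint (rowOp T.op) x)
      = inner ℂ y (ContinuousLinearMap.adjoint (T.op j) x) := by
    rw [ContinuousLinearMap.adjoint_inner_right, ContinuousLinearMap.adjoint_inner_right]
    congr 1
    simp [rowOp, coord, apply_ite]
  rw [← h, PiLp.inner_apply, Finset.sum_eq_single j]
  · simp [coord]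
  · intro i _ hi
    simp [coord, hi]
  · simp

theorem norm_starMap (x : H) :
    ‖𝒟.starMap x‖ = ‖defectOp (ContinuousLinearMap.adjoint (rowOp T.op)) x‖ := by
  set y : Copies d H := ContinuousLinearMap.adjoint (rowOp T.op) x with hy
  have hyj : ∀ j, y j = ContinuousLinearMap.adjoint (T.op j) x := adjoint_rowOp x
  have hc : ∀ z, ‖ContinuousLinearMap.adjoint (rowOp T.op) z‖ ≤ ‖z‖ := by
    intro z
    refine (ContinuousLinearMap.le_opNorm _ _).trans ?_
    rw [LinearIsometryEquiv.norm_map]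
    refine mul_le_of_le_one_left (norm_nonneg _) ?_
    exact ContinuousLinearMap.opNorm_le_bound _ zero_le_one (by simpa using T.contractive)
  rw [← sq_eq_sq₀ (norm_nonneg _) (norm_nonneg _), norm_defectOp_sq _ hc, ← hy]
  have h0 : 𝒟.starMap x = 𝒟.emb x - ∑ j, 𝒟.V j (𝒟.emb (y j)) := by
    simp [starMap, hyj]
  have h1 : ‖∑ j, 𝒟.V j (𝒟.emb (y j))‖ ^ 2 = ‖y‖ ^ 2 := 𝒟.norm_sum_V_emb y
  have h2 : inner ℂ (𝒟.emb x) (∑ j, 𝒟.V j (𝒟.emb (y j))) = inner ℂ y y := by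
    simp only [inner_sum, 𝒟.inner_V_emb, PiLp.inner_apply]
    refine Finset.sum_congr rfl fun j _ => ?_
    rw [← ContinuousLinearMap.adjoint_inner_left, ← hyj]
  rw [h0, @norm_sub_sq ℂ, h1, h2, 𝒟.emb.norm_map, inner_self_eq_norm_sq]
  ring

/-- The canonical isometry `D_T → K`, `D_T ξ ↦ ∑_j (V_j - T_j) ξ_j`. Its range is `L_T`. -/
def defectIso : T.defect →ₗᵢ[ℂ] K := defectLift _ 𝒟.defectMap 𝒟.norm_defectMap

/-- The canonical isometry `D_{*,T} → K`, `D_{*,T} ξ ↦ (1 - ∑_j V_j T_j*) ξ`. Its range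
is `L_{*,T}`. -/
def starIso : T.starDefect →ₗᵢ[ℂ] K := defectLift _ 𝒟.starMap 𝒟.norm_starMap

theorem inner_emb_word_defectIso (α : List (Fin d)) (h : H) (δ : T.defect) :
    inner ℂ (𝒟.emb h) (wordOp 𝒟.V α (𝒟.defectIso δ)) = 0 := by
  refine (denseRange_toDefect (rowOp T.op)).induction (P := fun δ =>
    inner ℂ (𝒟.emb h) (wordOp 𝒟.V α (𝒟.defectIso δ)) = 0) ?_
    (isClosed_eq (by fun_prop) (by fun_prop)) δ
  rintro _ ⟨x, rfl⟩
  rw [defectIso, defectLift_apply]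
  have h1 : ∀ j (y : H), wordOp 𝒟.V α (𝒟.V j (𝒟.emb y))
      = wordOp 𝒟.V (α ++ [j]) (𝒟.emb y) := by
    intro j y; simp [wordOp]
  have h2 : ∀ j (y : H), wordOp T.op α (T.op j y) = wordOp T.op (α ++ [j]) y := by
    intro j y; simp [wordOp]
  simp [defectMap, rowOp, h1, h2, 𝒟.dilation, map_sum]

theorem wandering_defectIso (j : Fin d) (α : List (Fin d)) (x y : T.defect) :
    inner ℂ (𝒟.defectIso x) (𝒟.V j (wordOp 𝒟.V α (𝒟.defectIso y))) = 0 := by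
  refine (denseRange_toDefect (rowOp T.op)).induction (P := fun x =>
    inner ℂ (𝒟.defectIso x) (𝒟.V j (wordOp 𝒟.V α (𝒟.defectIso y))) = 0) ?_
    (isClosed_eq (by fun_prop) (by fun_prop)) x
  rintro _ ⟨x, rfl⟩
  have h1 : ∀ h, inner ℂ (𝒟.emb h) (𝒟.V j (wordOp 𝒟.V α (𝒟.defectIso y))) = 0 := by
    intro h; simpa [wordOp] using 𝒟.inner_emb_word_defectIso (j :: α) h y
  have h2 : ∀ h, inner ℂ (𝒟.emb h) (wordOp 𝒟.V α (𝒟.defectIso y)) = 0 :=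
    fun h => 𝒟.inner_emb_word_defectIso α h y
  have h3 : 𝒟.defectIso (toDefect (rowOp T.op) x) = 𝒟.defectMap x := defectLift_apply _ _ _ _
  rw [h3]
  simp [defectMap, rowOp, 𝒟.isRowIsometry _ j, h1, h2, map_sum]

theorem inner_starIso_V (j : Fin d) (α : List (Fin d)) (x : T.starDefect) (h : H) :
    inner ℂ (𝒟.starIso x) (𝒟.V j (wordOp 𝒟.V α (𝒟.emb h))) = 0 := by
  refine (denseRange_toDefect (ContinuousLinearMap.adjoint (rowOp T.op))).induction
    (P := fun x => inner ℂ (𝒟.starIso x) (𝒟.V j (wordOp 𝒟.V α (𝒟.emb h))) = 0) ?_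
    (isClosed_eq (by fun_prop) (by fun_prop)) x
  rintro _ ⟨x, rfl⟩
  have h1 : inner ℂ (𝒟.emb x) (𝒟.V j (wordOp 𝒟.V α (𝒟.emb h)))
      = inner ℂ x (T.op j (wordOp T.op α h)) := by
    simpa [wordOp] using 𝒟.dilation (j :: α) h x
  have h3 : 𝒟.starIso (toDefect (ContinuousLinearMap.adjoint (rowOp T.op)) x) = 𝒟.starMap x :=
    defectLift_apply _ _ _ _
  rw [h3]
  simp [starMap, 𝒟.isRowIsometry _ j, h1, 𝒟.dilation,
    ContinuousLinearMap.adjoint_inner_left]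

theorem wandering_starIso (j : Fin d) (α : List (Fin d)) (x y : T.starDefect) :
    inner ℂ (𝒟.starIso x) (𝒟.V j (wordOp 𝒟.V α (𝒟.starIso y))) = 0 := by
  refine (denseRange_toDefect (ContinuousLinearMap.adjoint (rowOp T.op))).induction
    (P := fun y => inner ℂ (𝒟.starIso x) (𝒟.V j (wordOp 𝒟.V α (𝒟.starIso y))) = 0) ?_
    (isClosed_eq (by fun_prop) (by fun_prop)) y
  rintro _ ⟨y, rfl⟩
  have h1 : ∀ i (h : H), wordOp 𝒟.V α (𝒟.V i (𝒟.emb h))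
      = wordOp 𝒟.V (α ++ [i]) (𝒟.emb h) := by
    intro i h; simp [wordOp]
  have h3 : 𝒟.starIso (toDefect (ContinuousLinearMap.adjoint (rowOp T.op)) y) = 𝒟.starMap y :=
    defectLift_apply _ _ _ _
  rw [h3]
  simp [starMap, map_sum, h1, 𝒟.inner_starIso_V]

/-- The space `L_T = span {H, V (H ⊕ ⋯ ⊕ H)} ⊖ H` (closed span). -/
def wanderingSpace : Submodule ℂ K := wandering 𝒟.V (LinearMap.range 𝒟.emb.toLinearMap)

/-- The space `L_{*,T}`: the restriction `V^T` of `V` to the smallest closed `V`-invariant subspace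
containing `H` is a minimal isometric dilation of `T`, and `L_{*,T} = ker (V^T)*`. -/
def starWanderingSpace : Submodule ℂ K := starWandering 𝒟.V (LinearMap.range 𝒟.emb.toLinearMap)

/-- The canonical isometry `Γ ⊗ D_T → K` onto the closed span of the spaces `V_α L_T`. -/
def defectShift : Fock d T.defect →ₗᵢ[ℂ] K :=
  shiftEmb 𝒟.isRowIsometry 𝒟.defectIso 𝒟.wandering_defectIso

/-- The canonical isometry `Γ ⊗ D_{*,T} → K` onto the closed span of the spaces `V_α L_{*,T}`. -/
def starShift : Fock d T.starDefect →ₗᵢ[ℂ] K :=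
  shiftEmb 𝒟.isRowIsometry 𝒟.starIso 𝒟.wandering_starIso

end IsometricDilation

end Dilation

/-! ## Orthogonal sums of two Hilbert spaces -/

section Sum

variable (X : Type u) (Y : Type v) [NormedAddCommGroup X] [InnerProductSpace ℂ X]
  [NormedAddCommGroup Y] [InnerProductSpace ℂ Y]

/-- The embedding `x ↦ x ⊕ 0`. -/
def inFst : X →ₗᵢ[ℂ] WithLp 2 (X × Y) where
  toFun x := WithLp.toLp 2 (x, 0)
  map_add' x y := by rw [← WithLp.toLp_add]; simp
  map_smul' c x := by rw [← WithLp.toLp_smul]; simp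
  norm_map' x := by simp

/-- The embedding `y ↦ 0 ⊕ y`. -/
def inSnd : Y →ₗᵢ[ℂ] WithLp 2 (X × Y) where
  toFun y := WithLp.toLp 2 (0, y)
  map_add' x y := by rw [← WithLp.toLp_add]; simp
  map_smul' c x := by rw [← WithLp.toLp_smul]; simp
  norm_map' x := by simp

end Sum

/-! ## The minimal isometric dilation -/

section Schaeffer

variable {d : ℕ} {H : Type u} [NormedAddCommGroup H] [InnerProductSpace ℂ H] [CompleteSpace H]

namespace RowContraction

variable (T : RowContraction d H)

/-- The space `H ⊕ (Γ ⊗ D_T)` of the minimal isometric dilation of `T`. -/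
abbrev DilationSpace : Type u := WithLp 2 (H × Fock d T.defect)

/-- The operator `V_j (h ⊕ f) = T_j h ⊕ (e_∅ ⊗ D_T (h at position j) + (L_j ⊗ I) f)`. -/
def dilationOp (j : Fin d) : T.DilationSpace →L[ℂ] T.DilationSpace :=
  let W := WithLp.prodContinuousLinearEquiv 2 ℂ H (Fock d T.defect)
  (W.symm : (H × Fock d T.defect) →L[ℂ] T.DilationSpace).comp
    ((((T.op j).comp (ContinuousLinearMap.fst ℂ H (Fock d T.defect))).prod
      ((Fock.ket []).toContinuousLinearMap.comp
          ((toDefect (rowOp T.op)).comp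
            ((coord j).toContinuousLinearMap.comp (ContinuousLinearMap.fst ℂ H (Fock d T.defect))))
        + (Fock.creation j).toContinuousLinearMap.comp
            (ContinuousLinearMap.snd ℂ H (Fock d T.defect)))).comp
    (W : T.DilationSpace →L[ℂ] (H × Fock d T.defect)))

theorem dilationOp_apply (j : Fin d) (x : T.DilationSpace) :
    T.dilationOp j x = WithLp.toLp 2 (T.op j x.fst,
      Fock.ket [] (toDefect (rowOp T.op) (coord j x.fst)) + Fock.creation j x.snd) := rfl

theorem isRowIsometry_dilationOp : IsRowIsometry T.dilationOp := by
  have h1 : ∀ (i : Fin d) (δ : T.defect) (f : Fock d T.defect),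
      inner ℂ (Fock.ket [] δ) (Fock.creation i f) = 0 := by
    intro i δ f
    have h : ∀ α : List (Fin d), inner ℂ (Fock.ket [] δ : Fock d T.defect)
        (Fock.ket (i :: α) (f α)) = 0 := fun α => Fock.inner_ket_of_ne (by simp) _ _
    have hs := ((Fock.orthogonalFamily_cons (D := T.defect) i).hasSum_linearIsometry f).mapL
      (innerSL ℂ (Fock.ket [] δ : Fock d T.defect))
    refine hs.unique ?_
    convert hasSum_zero using 1
    ext α
    exact h α
  have h2 : ∀ (i j : Fin d) (f g : Fock d T.defect),
      inner ℂ (Fock.creation i f) (Fock.creation j g) = if i = j then inner ℂ f g else 0 := by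
    intro i j f g
    by_cases hij : i = j
    · subst hij; simp
    rw [if_neg hij]
    have hs := ((Fock.orthogonalFamily_cons (D := T.defect) j).hasSum_linearIsometry g).mapL
      (innerSL ℂ (Fock.creation i f : Fock d T.defect))
    refine hs.unique ?_
    convert hasSum_zero using 1
    ext α
    have hs' := ((Fock.orthogonalFamily_cons (D := T.defect) i).hasSum_linearIsometry f).mapL
      (innerSL ℂ (Fock.ket (j :: α) (g α) : Fock d T.defect))
    have h0 : inner ℂ (Fock.ket (j :: α) (g α) : Fock d T.defect) (Fock.creation i f) = 0 := by
      refine hs'.unique ?_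
      convert hasSum_zero using 1
      ext β
      exact Fock.inner_ket_of_ne (fun h => hij (List.cons.inj h).1.symm) _ _
    change inner ℂ (Fock.creation i f) (Fock.ket (j :: α) (g α) : Fock d T.defect) = 0
    rw [← inner_conj_symm, h0, map_zero]
  have h3 : ∀ x y : Copies d H, inner ℂ (toDefect (rowOp T.op) x) (toDefect (rowOp T.op) y)
      = inner ℂ x y - inner ℂ (rowOp T.op x) (rowOp T.op y) :=
    inner_toDefect _ T.contractive
  have h4 : ∀ (i j : Fin d) (x y : H), inner ℂ (coord i x : Copies d H) (coord j y)
      = if i = j then inner ℂ x y else 0 := by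
    intro i j x y
    by_cases hij : i = j
    · subst hij; simp
    · rw [if_neg hij, PiLp.inner_apply]
      refine Finset.sum_eq_zero fun k _ => ?_
      by_cases hk : k = i
      · have hkj : k ≠ j := fun h => hij (hk.symm.trans h)
        simp [coord, hkj]
      · simp [coord, hk]
  have h5 : ∀ (i : Fin d) (x : H), rowOp T.op (coord i x) = T.op i x := by
    intro i x
    simp [rowOp, coord, apply_ite]
  intro i j x y
  rw [WithLp.prod_inner_apply]
  simp only [dilationOp_apply, inner_add_left, inner_add_right, h1, h2,
    LinearIsometry.inner_map_map, h3, h4, h5]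
  have h6 : inner ℂ (Fock.creation i x.snd) (Fock.ket [] (toDefect (rowOp T.op) (coord j y.fst)))
      = 0 := by
    rw [← inner_conj_symm, h1, map_zero]
  rw [h6, WithLp.prod_inner_apply]
  split_ifs
  · simp only [WithLp.ofLp_fst, WithLp.ofLp_snd]; ring
  · ring

/-- The minimal isometric dilation of `T`, on `H ⊕ (Γ ⊗ D_T)`. -/
def dilation : IsometricDilation T T.DilationSpace where
  V := T.dilationOp
  emb := inFst H (Fock d T.defect)
  isRowIsometry := T.isRowIsometry_dilationOp
  dilation := by
    have h : ∀ (α : List (Fin d)) (x : T.DilationSpace),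
        (wordOp T.dilationOp α x).fst = wordOp T.op α x.fst := by
      intro α
      induction α with
      | nil => intro x; simp [wordOp]
      | cons i α ih =>
        intro x
        have := congrArg (T.op i) (ih x)
        simpa [wordOp, dilationOp_apply] using this
    intro α x y
    rw [WithLp.prod_inner_apply]
    simp only [WithLp.ofLp_fst, WithLp.ofLp_snd]
    rw [h]
    simp [inFst]

/-- Popescu's characteristic function `M_{Θ_T} : Γ ⊗ D_T → Γ ⊗ D_{*,T}`: in the minimal isometric
dilation of `T`, the orthogonal projection onto the row shift part `⨁_α V_α L_{*,T}`, restricted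
to `Γ ⊗ D_T = ⨁_α V_α L_T`. -/
def charFun : Fock d T.defect →L[ℂ] Fock d T.starDefect :=
  (ContinuousLinearMap.adjoint T.dilation.starShift.toContinuousLinearMap).comp
    T.dilation.defectShift.toContinuousLinearMap

end RowContraction

end Schaeffer

/-! ## Liftings -/

section Lifting

variable {d : ℕ} {HC : Type u} {HA : Type v}
  [NormedAddCommGroup HC] [InnerProductSpace ℂ HC] [CompleteSpace HC]
  [NormedAddCommGroup HA] [InnerProductSpace ℂ HA] [CompleteSpace HA]

/-- `E` is a lifting of `C` with lower right corner `A`: for some `B_j : H_C → H_A`, `E_j` is the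
block operator with rows `(C_j, 0)` and `(B_j, A_j)` on `H_E = H_C ⊕ H_A`. (As `E` is a row
contraction, so is its compression `A` to `H_A`; this is no restriction on the lifting.) -/
def IsLifting (C : RowContraction d HC) (A : RowContraction d HA)
    (E : RowContraction d (WithLp 2 (HC × HA))) : Prop :=
  ∃ B : Fin d → HC →L[ℂ] HA, ∀ j c a,
    E.op j (WithLp.toLp 2 (c, a)) = WithLp.toLp 2 (C.op j c, B j c + A.op j a)

/-- A lifting `E` on `H_C ⊕ H_A` is minimal if the vectors `E_α x` with `x ∈ H_C` and `α` a word
have dense linear span. -/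
def IsMinimalLifting (E : RowContraction d (WithLp 2 (HC × HA))) : Prop :=
  (Submodule.span ℂ {y | ∃ (α : List (Fin d)) (x : HC),
    y = wordOp E.op α (inFst HC HA x)}).topologicalClosure = ⊤

namespace IsLifting

variable {C : RowContraction d HC} {A : RowContraction d HA}
  {E : RowContraction d (WithLp 2 (HC × HA))}

theorem wordOp_fst (h : IsLifting C A E) (α : List (Fin d)) (x : WithLp 2 (HC × HA)) :
    (wordOp E.op α x).fst = wordOp C.op α x.fst := by
  obtain ⟨B, hB⟩ := h
  induction α with
  | nil => simp [wordOp]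
  | cons i α ih =>
    have h1 : (E.op i (wordOp E.op α x)).fst = C.op i (wordOp E.op α x).fst :=
      congrArg WithLp.fst (hB i (wordOp E.op α x).fst (wordOp E.op α x).snd)
    rw [ih] at h1
    simpa [wordOp] using h1

theorem wordOp_inSnd (h : IsLifting C A E) (α : List (Fin d)) (a : HA) :
    wordOp E.op α (inSnd HC HA a) = inSnd HC HA (wordOp A.op α a) := by
  obtain ⟨B, hB⟩ := h
  induction α with
  | nil => simp [wordOp]
  | cons i α ih =>
    have h1 : E.op i (inSnd HC HA (wordOp A.op α a))
        = inSnd HC HA (A.op i (wordOp A.op α a)) := by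
      change E.op i (WithLp.toLp 2 (0, wordOp A.op α a)) = _
      rw [hB]
      simp [inSnd]
    rw [← ih] at h1
    simpa [wordOp] using h1

/-- The minimal isometric dilation of `E` is an isometric dilation of `C`. -/
def dilationC (h : IsLifting C A E) : IsometricDilation C E.DilationSpace where
  V := E.dilation.V
  emb := E.dilation.emb.comp (inFst HC HA)
  isRowIsometry := E.dilation.isRowIsometry
  dilation := by
    intro α x y
    change inner ℂ (E.dilation.emb (inFst HC HA y))
      (wordOp E.dilation.V α (E.dilation.emb (inFst HC HA x))) = _
    rw [E.dilation.dilation, WithLp.prod_inner_apply]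
    simp only [WithLp.ofLp_fst, WithLp.ofLp_snd]
    rw [h.wordOp_fst]
    simp [inFst]

/-- The minimal isometric dilation of `E` is an isometric dilation of `A`. -/
def dilationA (h : IsLifting C A E) : IsometricDilation A E.DilationSpace where
  V := E.dilation.V
  emb := E.dilation.emb.comp (inSnd HC HA)
  isRowIsometry := E.dilation.isRowIsometry
  dilation := by
    intro α x y
    change inner ℂ (E.dilation.emb (inSnd HC HA y))
      (wordOp E.dilation.V α (E.dilation.emb (inSnd HC HA x))) = _
    rw [E.dilation.dilation, h.wordOp_inSnd, LinearIsometry.inner_map_map]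

/-- The characteristic function `M_{C,E} : Γ ⊗ D_E → Γ ⊗ D_C` of the lifting `E` of `C`: in the
minimal isometric dilation of `E`, the orthogonal projection onto `⨁_α V_α L_C`, restricted to
`⨁_α V_α L_E`, with these spaces canonically identified with `Γ ⊗ D_C` and `Γ ⊗ D_E`. -/
def charFun (h : IsLifting C A E) : Fock d E.defect →L[ℂ] Fock d C.defect :=
  (ContinuousLinearMap.adjoint h.dilationC.defectShift.toContinuousLinearMap).comp
    E.dilation.defectShift.toContinuousLinearMap

/-- Inside the space of the minimal isometric dilation of `E`: `L_E = L_A` and `L_C = L_{*,A}`. -/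
def SpacesAgree (h : IsLifting C A E) : Prop :=
  E.dilation.wanderingSpace = h.dilationA.wanderingSpace ∧
    h.dilationC.wanderingSpace = h.dilationA.starWanderingSpace

/-- `M_{C,E} = M_{Θ_A}` with the canonical identifications: the canonical images of `D_E` and `D_A`
in the dilation space of `E` agree, which identifies `D_E` with `D_A` by a unitary `u`; likewise
`D_C` is identified with `D_{*,A}` by a unitary `u'`; and the two operators correspond to each
other under `I ⊗ u` and `I ⊗ u'`. -/
def CharFunEqPopescu (h : IsLifting C A E) : Prop :=
  ∃ (u : E.defect ≃ₗᵢ[ℂ] A.defect) (u' : C.defect ≃ₗᵢ[ℂ] A.starDefect),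
    (∀ δ, h.dilationA.defectIso (u δ) = E.dilation.defectIso δ) ∧
    (∀ δ, h.dilationA.starIso (u' δ) = h.dilationC.defectIso δ) ∧
    ∀ f, A.charFun (Fock.ampliation u.toLinearIsometry f) =
      Fock.ampliation u'.toLinearIsometry (h.charFun f)

end IsLifting

end Lifting

end RowLift

end

/-!
Everything takes place in the minimal isometric dilation `V` of `E`, on `K = H_E ⊕ W` with
`W = ⨁_α V_α L_E`. The space `H_C` is invariant under the `V_j*`, so the closed `V`-invariant space
`K_C = H_C ⊕ ⨁_α V_α L_C` is reducing; let `N` be its orthogonal complement. Minimality of the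
lifting says exactly that `H_E ∩ N = 0`.

Part (1). A vector of `L_E` keeps its norm under the projection to `L_C` only if it lies in `L_C`,
so pure contractivity means `L_E ∩ L_C = 0` (`isPurelyContractive_iff`). The defect operator of
`M_{C,E}` has the same norms as the projection `P_N` restricted to `W`, and `P_N W` is dense in `N`;
hence the Szegő condition means that `⨁_j V_j N` is dense in `N`, i.e. that `V|_N` has no wandering
vectors (`szegoCondition_iff`). Put `Y = K ⊖ H_C = (⨁_α V_α L_C) ⊕ N`. If both conditions hold,
then `Y ⊖ ⨁_j V_j Y = L_C`, and a vector of `L_E ⊖ L_A` is orthogonal to `⨁_j V_j Y`, hence lies in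
`L_E ∩ L_C = 0`. So `L_E = L_A`, the `V`-invariant space generated by `H_A` is `Y`, and
`L_{*,A} = L_C`. The converse runs along the same lines
(`purelyContractive_and_szego_iff_of_isMinimal`). The equality of the characteristic functions holds
because `M_{Θ_A}` can be computed in any isometric dilation of `A` (`inner_charFun`).

Part (2). For a unitary `w : D_C → D_{*,A}` take `B = D_{*,A} w D_C`. The row `(D_{*,A}, A)` is
contractive, so `E` is a row contraction, and `w` becomes the identification of `L_C` with
`L_{*,A}` (`overC_defectIso_eq`), from which `L_E = L_A` follows. The vectors orthogonal
to all `E_α H_C` form a subspace of `H_A` that is invariant under the `A_j*` and on which `D_{*,A}`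
vanishes; since `A` is completely non-coisometric it is zero (`IsCNC.eq_zero`), and the lifting is
minimal.

Part (3). For a completely non-coisometric `A` the vectors `g + f` with `g ∈ ⨁_α V_α L_{*,A}` and
`f ∈ ⨁_α V_α L_A` are dense in the minimal dilation space (`denseRange_shiftSum`), and their norms
are expressed by the characteristic function. So coinciding characteristic functions give a unitary
of the dilation spaces which intertwines the dilations and respects `⨁_α V_α L_A`, hence also its
orthogonal complement `H_A`; it restricts to a unitary equivalence.
-/

open RowLift

noncomputable section

namespace RowLift

universe u v

set_option linter.unusedSectionVars false

open ContinuousLinearMap (adjoint adjoint_inner_left adjoint_inner_right)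

/-! ### Isometries between Hilbert spaces -/

section Isometries

variable {X : Type*} {Y : Type*} {K : Type*}
  [NormedAddCommGroup X] [InnerProductSpace ℂ X]
  [NormedAddCommGroup Y] [InnerProductSpace ℂ Y]
  [NormedAddCommGroup K] [InnerProductSpace ℂ K]

theorem isClosed_range_linearIsometry [CompleteSpace X] (f : X →ₗᵢ[ℂ] K) :
    IsClosed (LinearMap.range f.toLinearMap : Set K) := by
  rw [LinearMap.coe_range]
  exact f.isometry.isClosedEmbedding.isClosed_range

theorem exists_unitary_of_range_eq (f : X →ₗᵢ[ℂ] K) (g : Y →ₗᵢ[ℂ] K)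
    (h : LinearMap.range f.toLinearMap = LinearMap.range g.toLinearMap) :
    ∃ u : X ≃ₗᵢ[ℂ] Y, ∀ x, g (u x) = f x := by
  let e : X ≃ₗᵢ[ℂ] Y := f.equivRange.trans
    ((LinearIsometryEquiv.ofEq _ _ h).trans g.equivRange.symm)
  refine ⟨e, fun x => ?_⟩
  have h1 : g.equivRange (e x) = LinearIsometryEquiv.ofEq _ _ h (f.equivRange x) := by simp [e]
  exact congrArg Subtype.val h1

/-- Two linear maps with dense ranges and `‖f x‖ = ‖g x‖` are carried to each other by a
unitary. -/
theorem exists_unitary_of_norm_eq {Z : Type*} [AddCommGroup Z] [Module ℂ Z] {K' : Type*}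
    [NormedAddCommGroup K'] [InnerProductSpace ℂ K']
    [CompleteSpace K] [CompleteSpace K'] (f : Z →ₗ[ℂ] K) (g : Z →ₗ[ℂ] K')
    (hf : DenseRange f) (hg : DenseRange g) (h : ∀ x, ‖f x‖ = ‖g x‖) :
    ∃ Ψ : K ≃ₗᵢ[ℂ] K', ∀ x, Ψ (f x) = g x := by
  have hn : ∀ x, ‖g x‖ ≤ 1 * ‖f x‖ := fun x => by rw [one_mul, h]
  let Φ : K →L[ℂ] K' := g.extendOfNorm f
  have hΦ : ∀ x, Φ (f x) = g x := fun x => LinearMap.extendOfNorm_eq hf ⟨1, hn⟩ x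
  have hnorm : ∀ y, ‖Φ y‖ = ‖y‖ := fun y =>
    hf.induction (P := fun y => ‖Φ y‖ = ‖y‖) (by rintro _ ⟨x, rfl⟩; rw [hΦ, h])
      (isClosed_eq (by fun_prop) (by fun_prop)) y
  let Φ' : K →ₗᵢ[ℂ] K' := ⟨Φ.toLinearMap, hnorm⟩
  have hsurj : Function.Surjective Φ' := by
    intro y
    have hcl := isClosed_range_linearIsometry Φ'
    have hsub : Set.range g ⊆ (LinearMap.range Φ'.toLinearMap : Set K') := by
      rintro _ ⟨x, rfl⟩
      exact ⟨f x, hΦ x⟩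
    have hy := hcl.closure_subset_iff.2 hsub (hg y)
    exact hy
  exact ⟨LinearIsometryEquiv.ofSurjective Φ' hsurj, hΦ⟩

/-- Two isometries with orthogonal ranges combine to an isometry on the orthogonal sum. -/
def sumIsometry (f : X →ₗᵢ[ℂ] K) (g : Y →ₗᵢ[ℂ] K) (h : ∀ x y, inner ℂ (f x) (g y) = 0) :
    WithLp 2 (X × Y) →ₗᵢ[ℂ] K where
  toFun x := f x.fst + g x.snd
  map_add' x y := by simp only [WithLp.add_fst, WithLp.add_snd, map_add]; abel
  map_smul' c x := by simp [smul_add]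
  norm_map' x := by
    change ‖f x.fst + g x.snd‖ = ‖x‖
    rw [← sq_eq_sq₀ (norm_nonneg _) (norm_nonneg _), @norm_add_sq ℂ, h,
      WithLp.prod_norm_sq_eq_of_L2]
    simp

theorem sumIsometry_apply (f : X →ₗᵢ[ℂ] K) (g : Y →ₗᵢ[ℂ] K) (h : ∀ x y, inner ℂ (f x) (g y) = 0)
    (x : WithLp 2 (X × Y)) : sumIsometry f g h x = f x.fst + g x.snd := rfl

theorem inFst_add_inSnd (x : WithLp 2 (X × Y)) : inFst X Y x.fst + inSnd X Y x.snd = x := by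
  change WithLp.toLp 2 (x.fst, 0) + WithLp.toLp 2 (0, x.snd) = x
  rw [← WithLp.toLp_add]
  simp
  rfl

@[simp] theorem inFst_fst (x : X) : (inFst X Y x).fst = x := rfl
@[simp] theorem inFst_snd (x : X) : (inFst X Y x).snd = 0 := rfl
@[simp] theorem inSnd_fst (y : Y) : (inSnd X Y y).fst = 0 := rfl
@[simp] theorem inSnd_snd (y : Y) : (inSnd X Y y).snd = y := rfl

theorem inner_inFst_left (x : X) (z : WithLp 2 (X × Y)) :
    inner ℂ (inFst X Y x) z = inner ℂ x z.fst := by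
  rw [WithLp.prod_inner_apply]; simp [inFst]

theorem inner_inSnd_right (y : Y) (z : WithLp 2 (X × Y)) :
    inner ℂ z (inSnd X Y y) = inner ℂ z.snd y := by
  rw [WithLp.prod_inner_apply]; simp [inSnd]

/-- Whether `f(S)` is dense in the range of `f` depends only on the norms `‖f x‖`; this allows the
defect operator of a contraction to be replaced by any operator with the same norms. -/
theorem range_closure_eq_map_closure_iff (f : X →ₗ[ℂ] Y) (S : Submodule ℂ X) :
    (LinearMap.range f).topologicalClosure = (S.map f).topologicalClosure ↔
      ∀ x, ∀ ε > 0, ∃ s ∈ S, ‖f (x - s)‖ < ε := by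
  constructor
  · intro h x ε hε
    have hx : f x ∈ (S.map f).topologicalClosure :=
      h ▸ Submodule.le_topologicalClosure _ ⟨x, rfl⟩
    obtain ⟨_, ⟨s, hs, rfl⟩, hd⟩ := Metric.mem_closure_iff.1 hx ε hε
    exact ⟨s, hs, by rwa [map_sub, ← dist_eq_norm]⟩
  · intro h
    refine le_antisymm ?_ (Submodule.topologicalClosure_mono
      (by rintro _ ⟨s, -, rfl⟩; exact ⟨s, rfl⟩))
    refine Submodule.topologicalClosure_minimal _ ?_ (Submodule.isClosed_topologicalClosure _)
    rintro _ ⟨x, rfl⟩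
    refine Metric.mem_closure_iff.2 fun ε hε => ?_
    obtain ⟨s, hs, hd⟩ := h x ε hε
    exact ⟨f s, ⟨s, hs, rfl⟩, by rwa [dist_eq_norm, ← map_sub]⟩

end Isometries

/-! ### Hilbert space dimension -/

theorem exists_hilbertBasis_card_eq_hilbertDim (X : Type u) [NormedAddCommGroup X]
    [InnerProductSpace ℂ X] [CompleteSpace X] :
    ∃ (s : Set X) (_ : HilbertBasis s ℂ X), hilbertDim X = Cardinal.mk s := by
  obtain ⟨s, b, -⟩ := exists_hilbertBasis ℂ X
  exact csInf_mem (s := {κ | ∃ (s : Set X) (_ : HilbertBasis s ℂ X), κ = Cardinal.mk s})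
    ⟨_, s, b, rfl⟩

/-- Hilbert spaces of the same dimension are unitarily equivalent. -/
theorem SameHilbertDim.exists_unitary {X : Type u} {Y : Type v}
    [NormedAddCommGroup X] [InnerProductSpace ℂ X] [CompleteSpace X]
    [NormedAddCommGroup Y] [InnerProductSpace ℂ Y] [CompleteSpace Y] (h : SameHilbertDim X Y) :
    Nonempty (X ≃ₗᵢ[ℂ] Y) := by
  obtain ⟨s, b, hs⟩ := exists_hilbertBasis_card_eq_hilbertDim X
  obtain ⟨t, c, ht⟩ := exists_hilbertBasis_card_eq_hilbertDim Y
  have hst : Cardinal.lift.{v} (Cardinal.mk s) = Cardinal.lift.{u} (Cardinal.mk t) := by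
    rw [← hs, ← ht]; exact h
  obtain ⟨e⟩ := Cardinal.lift_mk_eq'.1 hst
  have hc : Orthonormal ℂ (fun i => c (e i)) := c.orthonormal.comp e e.injective
  have hsp : ⊤ ≤ (Submodule.span ℂ (Set.range fun i => c (e i))).topologicalClosure := by
    have : Set.range (fun i => c (e i)) = Set.range c := e.surjective.range_comp c
    rw [this, c.dense_span]
  exact ⟨b.repr.trans (HilbertBasis.mk hc hsp).repr.symm⟩

/-! ### Operators on the Fock space -/

section FockOperators

variable {d : ℕ} {D : Type*} {D' : Type*} {F : Type*} {K : Type*}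
  [NormedAddCommGroup D] [InnerProductSpace ℂ D]
  [NormedAddCommGroup D'] [InnerProductSpace ℂ D']
  [NormedAddCommGroup F] [NormedSpace ℂ F]
  [NormedAddCommGroup K] [InnerProductSpace ℂ K]

theorem Fock.hasSum_ket (f : Fock d D) : HasSum (fun α => Fock.ket α (f α)) f :=
  lp.hasSum_single (E := fun _ : List (Fin d) => D) (p := 2) (by simp) f

theorem Fock.map_eq_zero (A : Fock d D →L[ℂ] F) (f : Fock d D)
    (h : ∀ α, A (Fock.ket α (f α)) = 0) : A f = 0 := by
  have hs := (Fock.hasSum_ket f).mapL A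
  simp only [h] at hs
  exact hs.unique hasSum_zero

theorem Fock.ext_ket {A B : Fock d D →L[ℂ] F}
    (h : ∀ α δ, A (Fock.ket α δ) = B (Fock.ket α δ)) : A = B := by
  ext f
  rw [← sub_eq_zero, ← sub_apply]
  exact Fock.map_eq_zero _ f fun α => by simp [h]

theorem Fock.inner_ket_left (α : List (Fin d)) (δ : D) (f : Fock d D) :
    inner ℂ (Fock.ket α δ) f = inner ℂ δ (f α) :=
  lp.inner_single_left (G := fun _ : List (Fin d) => D) α δ f

theorem Fock.ext_inner_ket {f g : Fock d D}
    (h : ∀ α δ, inner ℂ (Fock.ket α δ) f = inner ℂ (Fock.ket α δ) g) : f = g := by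
  refine lp.ext (funext fun α => ext_inner_left ℂ fun δ => ?_)
  rw [← Fock.inner_ket_left, ← Fock.inner_ket_left, h]

theorem Fock.ket_apply_self (α : List (Fin d)) (δ : D) : Fock.ket α δ α = δ :=
  lp.single_apply_self (E := fun _ : List (Fin d) => D) 2 α δ

theorem Fock.mem_vacuum_orthogonal (f : Fock d D) : f ∈ (Fock.vacuum d D)ᗮ ↔ f [] = 0 := by
  rw [Submodule.mem_orthogonal]
  constructor
  · intro h
    refine ext_inner_left ℂ fun δ => ?_
    rw [← Fock.inner_ket_left, inner_zero_right]
    exact h _ ⟨δ, rfl⟩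
  · rintro h _ ⟨δ, rfl⟩
    exact (Fock.inner_ket_left [] δ f).trans (by rw [h, inner_zero_right])

variable [CompleteSpace D]

theorem Fock.creation_mem_vacuum_orthogonal (j : Fin d) (f : Fock d D) :
    Fock.creation j f ∈ (Fock.vacuum d D)ᗮ := by
  rw [Submodule.mem_orthogonal]
  rintro _ ⟨δ, rfl⟩
  refine Fock.map_eq_zero (((innerSL ℂ) (Fock.ket [] δ : Fock d D)).comp
    (Fock.creation j).toContinuousLinearMap) f fun α => ?_
  change inner ℂ (Fock.ket [] δ) (Fock.creation j (Fock.ket α (f α))) = 0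
  rw [Fock.creation_ket]
  exact Fock.inner_ket_of_ne (by simp) _ _

theorem Fock.inner_creation (i j : Fin d) (f g : Fock d D) :
    inner ℂ (Fock.creation i f) (Fock.creation j g) = if i = j then inner ℂ f g else 0 := by
  by_cases hij : i = j
  · rw [if_pos hij, hij, LinearIsometry.inner_map_map]
  rw [if_neg hij]
  refine Fock.map_eq_zero (((innerSL ℂ) (Fock.creation i f)).comp
    (Fock.creation j).toContinuousLinearMap) g fun α => ?_
  change inner ℂ (Fock.creation i f) (Fock.creation j (Fock.ket α (g α))) = 0
  rw [inner_eq_zero_symm]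
  refine Fock.map_eq_zero (((innerSL ℂ) (Fock.creation j (Fock.ket α (g α)))).comp
    (Fock.creation i).toContinuousLinearMap) f fun β => ?_
  change inner ℂ (Fock.creation j (Fock.ket α (g α))) (Fock.creation i (Fock.ket β (f β))) = 0
  rw [Fock.creation_ket, Fock.creation_ket]
  exact Fock.inner_ket_of_ne (fun h => hij (List.cons.inj h).1.symm) _ _

/-- The ranges of the creation operators span the complement of the vacuum space. -/
theorem Fock.map_eq_zero_of_creation (A : Fock d D →L[ℂ] F)
    (h : ∀ j g, A (Fock.creation j g) = 0) {f : Fock d D} (hf : f [] = 0) : A f = 0 := by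
  refine Fock.map_eq_zero A f fun α => ?_
  cases α with
  | nil => rw [hf, map_zero, map_zero]
  | cons j β => rw [← Fock.creation_ket, h]

/-- A vector orthogonal to the ranges of all creation operators lies in the vacuum space. -/
theorem Fock.eq_ket_nil_of_inner_creation {f : Fock d D}
    (h : ∀ j g, inner ℂ f (Fock.creation j g) = 0) : f = Fock.ket [] (f []) := by
  have h0 : (f - Fock.ket [] (f []) : Fock d D) [] = 0 := by
    change f [] - Fock.ket (d := d) [] (f []) [] = 0
    rw [Fock.ket_apply_self, sub_self]
  have hg : ∀ j g, inner ℂ (f - Fock.ket [] (f [])) (Fock.creation j g) = 0 := by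
    intro j g
    rw [inner_sub_left, h, zero_sub, neg_eq_zero]
    exact (Submodule.mem_orthogonal _ _).1 (Fock.creation_mem_vacuum_orthogonal j g) _ ⟨_, rfl⟩
  rw [← sub_eq_zero, ← inner_self_eq_zero (𝕜 := ℂ)]
  exact Fock.map_eq_zero_of_creation ((innerSL ℂ) (f - Fock.ket [] (f []))) hg h0

theorem Fock.ampliation_creation [CompleteSpace D'] (v : D →ₗᵢ[ℂ] D') (j : Fin d)
    (f : Fock d D) : Fock.ampliation v (Fock.creation j f)
      = Fock.creation j (Fock.ampliation v f) := by
  have : (Fock.ampliation v).toContinuousLinearMap.comp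
        (Fock.creation (d := d) j).toContinuousLinearMap
      = (Fock.creation j).toContinuousLinearMap.comp
          (Fock.ampliation v).toContinuousLinearMap :=
    Fock.ext_ket fun α δ => by simp [Fock.creation_ket, Fock.ampliation_ket]
  exact DFunLike.congr_fun this f

theorem Fock.ampliation_surjective [CompleteSpace D'] (v : D ≃ₗᵢ[ℂ] D') :
    Function.Surjective (Fock.ampliation (d := d) v.toLinearIsometry) := by
  intro f
  refine ⟨Fock.ampliation v.symm.toLinearIsometry f, ?_⟩
  have : (Fock.ampliation (d := d) v.toLinearIsometry).toContinuousLinearMap.comp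
      (Fock.ampliation v.symm.toLinearIsometry).toContinuousLinearMap
      = ContinuousLinearMap.id ℂ _ :=
    Fock.ext_ket fun α δ => by simp [Fock.ampliation_ket]
  exact DFunLike.congr_fun this f

variable [CompleteSpace K]

theorem shiftEmb_creation {V : Fin d → K →L[ℂ] K} (hV : IsRowIsometry V) (ι : D →ₗᵢ[ℂ] K)
    (hw : ∀ j α x y, inner ℂ (ι x) (V j (wordOp V α (ι y))) = 0) (j : Fin d) (f : Fock d D) :
    shiftEmb hV ι hw (Fock.creation j f) = V j (shiftEmb hV ι hw f) := by
  have : (shiftEmb hV ι hw).toContinuousLinearMap.comp (Fock.creation j).toContinuousLinearMap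
      = (V j).comp (shiftEmb hV ι hw).toContinuousLinearMap :=
    Fock.ext_ket fun α δ => by simp [Fock.creation_ket, shiftEmb_ket, wordOp]
  exact DFunLike.congr_fun this f

theorem shiftEmb_ampliation [CompleteSpace D'] {V : Fin d → K →L[ℂ] K} (hV : IsRowIsometry V)
    (ι : D →ₗᵢ[ℂ] K) (hw : ∀ j α x y, inner ℂ (ι x) (V j (wordOp V α (ι y))) = 0)
    (ι' : D' →ₗᵢ[ℂ] K) (hw' : ∀ j α x y, inner ℂ (ι' x) (V j (wordOp V α (ι' y))) = 0)
    (v : D →ₗᵢ[ℂ] D') (hv : ∀ δ, ι' (v δ) = ι δ) (f : Fock d D) :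
    shiftEmb hV ι' hw' (Fock.ampliation v f) = shiftEmb hV ι hw f := by
  have : (shiftEmb hV ι' hw').toContinuousLinearMap.comp (Fock.ampliation v).toContinuousLinearMap
      = (shiftEmb hV ι hw).toContinuousLinearMap :=
    Fock.ext_ket fun α δ => by simp [Fock.ampliation_ket, shiftEmb_ket, hv]
  exact DFunLike.congr_fun this f

end FockOperators

/-! ### Row operators and invariant subspaces -/

section RowOperators

variable {d : ℕ} {H : Type*} {K : Type*} [NormedAddCommGroup H] [InnerProductSpace ℂ H]
  [NormedAddCommGroup K] [InnerProductSpace ℂ K]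

theorem wordOp_nil (T : Fin d → H →L[ℂ] H) (x : H) : wordOp T [] x = x := by simp [wordOp]

theorem wordOp_cons (T : Fin d → H →L[ℂ] H) (j : Fin d) (α : List (Fin d)) (x : H) :
    wordOp T (j :: α) x = T j (wordOp T α x) := by simp [wordOp]

theorem rowOp_apply (T : Fin d → H →L[ℂ] K) (x : Copies d H) : rowOp T x = ∑ j, T j (x j) := by
  simp [rowOp]

theorem rowOp_coord (T : Fin d → H →L[ℂ] K) (j : Fin d) (x : H) : rowOp T (coord j x) = T j x := by
  simp [rowOp, coord, apply_ite]

theorem sum_coord (x : Copies d H) : ∑ j, coord j (x j) = x := by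
  ext i
  simp [coord, WithLp.ofLp_sum]

theorem norm_copies_sq (x : Copies d H) : ‖x‖ ^ 2 = ∑ j, ‖x j‖ ^ 2 := PiLp.norm_sq_eq_of_L2 _ x

variable {V : Fin d → K →L[ℂ] K} {S : Submodule ℂ K}

theorem wordOp_mem_invariantHull (α : List (Fin d)) {x : K} (hx : x ∈ S) :
    wordOp V α x ∈ invariantHull V S :=
  Submodule.le_topologicalClosure _ (Submodule.mem_iSup_of_mem α ⟨x, hx, rfl⟩)

theorem invariantHull_le {M : Submodule ℂ K} (hM : IsClosed (M : Set K)) (hS : S ≤ M)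
    (hV : ∀ j, ∀ x ∈ M, V j x ∈ M) : invariantHull V S ≤ M := by
  refine Submodule.topologicalClosure_minimal _ (iSup_le fun α => ?_) hM
  rintro _ ⟨x, hx, rfl⟩
  change wordOp V α x ∈ M
  induction α with
  | nil => rw [wordOp_nil]; exact hS hx
  | cons j α ih => rw [wordOp_cons]; exact hV j _ ih

theorem map_mem_invariantHull (j : Fin d) {x : K} (hx : x ∈ invariantHull V S) :
    V j x ∈ invariantHull V S := by
  have : invariantHull V S ≤ (invariantHull V S).comap (V j : K →ₗ[ℂ] K) := by
    refine Submodule.topologicalClosure_minimal _ (iSup_le fun α => ?_)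
      ((Submodule.isClosed_topologicalClosure _).preimage (V j).continuous)
    rintro _ ⟨x, hx, rfl⟩
    change V j (wordOp V α x) ∈ invariantHull V S
    rw [← wordOp_cons]
    exact wordOp_mem_invariantHull _ hx
  exact this hx

theorem inner_eq_zero_of_mem_invariantHull {x k : K} (hx : x ∈ invariantHull V S)
    (hk : ∀ α, ∀ s ∈ S, inner ℂ (wordOp V α s) k = 0) : inner ℂ x k = 0 := by
  have : invariantHull V S ≤ (ℂ ∙ k)ᗮ := by
    refine Submodule.topologicalClosure_minimal _ (iSup_le fun α => ?_)
      (Submodule.isClosed_orthogonal _)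
    rintro _ ⟨s, hs, rfl⟩
    exact Submodule.mem_orthogonal_singleton_iff_inner_left.2 (hk α s hs)
  exact Submodule.mem_orthogonal_singleton_iff_inner_left.1 (this hx)

end RowOperators

/-! ### Isometric dilations -/

section Dilations

variable {d : ℕ} {H : Type*} {K : Type*}
  [NormedAddCommGroup H] [InnerProductSpace ℂ H] [CompleteSpace H]
  [NormedAddCommGroup K] [InnerProductSpace ℂ K] [CompleteSpace K]

theorem RowContraction.norm_adjoint_rowOp_le (T : RowContraction d H) (z : H) :
    ‖adjoint (rowOp T.op) z‖ ≤ ‖z‖ := by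
  refine (ContinuousLinearMap.le_opNorm _ _).trans ?_
  rw [LinearIsometryEquiv.norm_map]
  refine mul_le_of_le_one_left (norm_nonneg _) ?_
  exact ContinuousLinearMap.opNorm_le_bound _ zero_le_one (by simpa using T.contractive)

namespace IsometricDilation

variable {T : RowContraction d H} (𝒟 : IsometricDilation T K)

theorem defectIso_toDefect (x : Copies d H) :
    𝒟.defectIso (toDefect (rowOp T.op) x)
      = ∑ j, 𝒟.V j (𝒟.emb (x j)) - 𝒟.emb (rowOp T.op x) := by
  rw [defectIso, defectLift_apply, defectMap, sub_apply, rowOp_apply]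
  rfl

theorem starIso_toDefect (x : H) :
    𝒟.starIso (toDefect (adjoint (rowOp T.op)) x)
      = 𝒟.emb x - ∑ j, 𝒟.V j (𝒟.emb (adjoint (T.op j) x)) := by
  rw [starIso, defectLift_apply]
  simp [starMap]

theorem V_emb (j : Fin d) (h : H) : 𝒟.V j (𝒟.emb h)
    = 𝒟.emb (T.op j h) + 𝒟.defectIso (toDefect (rowOp T.op) (coord j h)) := by
  have h1 : ∑ i, 𝒟.V i (𝒟.emb (coord j h i)) = 𝒟.V j (𝒟.emb h) := by
    rw [Finset.sum_eq_single j]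
    · simp [coord]
    · intro i _ hi
      simp [coord, hi]
    · simp
  rw [defectIso_toDefect, h1, rowOp_coord]
  abel

theorem defectShift_ket (α : List (Fin d)) (δ : T.defect) :
    𝒟.defectShift (Fock.ket α δ) = wordOp 𝒟.V α (𝒟.defectIso δ) := shiftEmb_ket _ _ _ _ _

theorem starShift_ket (α : List (Fin d)) (δ : T.starDefect) :
    𝒟.starShift (Fock.ket α δ) = wordOp 𝒟.V α (𝒟.starIso δ) := shiftEmb_ket _ _ _ _ _

theorem defectShift_creation (j : Fin d) (f : Fock d T.defect) :
    𝒟.defectShift (Fock.creation j f) = 𝒟.V j (𝒟.defectShift f) := shiftEmb_creation _ _ _ _ _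

theorem starShift_creation (j : Fin d) (f : Fock d T.starDefect) :
    𝒟.starShift (Fock.creation j f) = 𝒟.V j (𝒟.starShift f) := shiftEmb_creation _ _ _ _ _

theorem inner_emb_defectShift (h : H) (f : Fock d T.defect) :
    inner ℂ (𝒟.emb h) (𝒟.defectShift f) = 0 := by
  refine Fock.map_eq_zero (((innerSL ℂ) (𝒟.emb h)).comp
    𝒟.defectShift.toContinuousLinearMap) f fun α => ?_
  change inner ℂ (𝒟.emb h) (𝒟.defectShift (Fock.ket α (f α))) = 0
  rw [defectShift_ket]
  exact 𝒟.inner_emb_word_defectIso α h _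

theorem inner_emb_defectIso (h : H) (δ : T.defect) :
    inner ℂ (𝒟.emb h) (𝒟.defectIso δ) = 0 := by
  simpa [wordOp] using 𝒟.inner_emb_word_defectIso [] h δ

/-- The embedding of the minimal isometric dilation into an arbitrary isometric dilation,
`h ⊕ f ↦ h + ∑_α V_α f_α`. -/
def dilationEmb : T.DilationSpace →ₗᵢ[ℂ] K :=
  sumIsometry 𝒟.emb 𝒟.defectShift 𝒟.inner_emb_defectShift

theorem dilationEmb_apply (x : T.DilationSpace) :
    𝒟.dilationEmb x = 𝒟.emb x.fst + 𝒟.defectShift x.snd := rfl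

/-- The embedding intertwines the minimal isometric dilation with `V`. -/
theorem dilationEmb_dilationOp (j : Fin d) (x : T.DilationSpace) :
    𝒟.dilationEmb (T.dilationOp j x) = 𝒟.V j (𝒟.dilationEmb x) := by
  rw [T.dilationOp_apply, dilationEmb_apply, dilationEmb_apply]
  change 𝒟.emb (T.op j x.fst) + 𝒟.defectShift
    (Fock.ket [] (toDefect (rowOp T.op) (coord j x.fst)) + Fock.creation j x.snd) = _
  rw [map_add, map_add, V_emb, defectShift_creation, defectShift_ket, wordOp_nil, add_assoc]

theorem dilationEmb_wordOp (α : List (Fin d)) (x : T.DilationSpace) :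
    𝒟.dilationEmb (wordOp T.dilationOp α x) = wordOp 𝒟.V α (𝒟.dilationEmb x) := by
  induction α with
  | nil => rw [wordOp_nil, wordOp_nil]
  | cons j α ih => rw [wordOp_cons, wordOp_cons, dilationEmb_dilationOp, ih]

theorem emb_mem_hull (h : H) :
    𝒟.emb h ∈ invariantHull 𝒟.V (LinearMap.range 𝒟.emb.toLinearMap) := by
  have := wordOp_mem_invariantHull (V := 𝒟.V) (S := LinearMap.range 𝒟.emb.toLinearMap) []
    ⟨h, rfl⟩
  rwa [wordOp_nil] at this

theorem wordOp_mem_hull {x : K} (hx : x ∈ invariantHull 𝒟.V (LinearMap.range 𝒟.emb.toLinearMap))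
    (α : List (Fin d)) :
    wordOp 𝒟.V α x ∈ invariantHull 𝒟.V (LinearMap.range 𝒟.emb.toLinearMap) := by
  induction α with
  | nil => rwa [wordOp_nil]
  | cons j α ih => rw [wordOp_cons]; exact map_mem_invariantHull j ih

theorem defectIso_mem_hull (δ : T.defect) :
    𝒟.defectIso δ ∈ invariantHull 𝒟.V (LinearMap.range 𝒟.emb.toLinearMap) := by
  refine (denseRange_toDefect (rowOp T.op)).induction (P := fun δ =>
    𝒟.defectIso δ ∈ invariantHull 𝒟.V (LinearMap.range 𝒟.emb.toLinearMap)) ?_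
    ((Submodule.isClosed_topologicalClosure _).preimage 𝒟.defectIso.continuous) δ
  rintro _ ⟨x, rfl⟩
  rw [defectIso_toDefect]
  exact Submodule.sub_mem _ (Submodule.sum_mem _ fun j _ =>
    map_mem_invariantHull j (𝒟.emb_mem_hull _)) (𝒟.emb_mem_hull _)

theorem starIso_mem_hull (δ : T.starDefect) :
    𝒟.starIso δ ∈ invariantHull 𝒟.V (LinearMap.range 𝒟.emb.toLinearMap) := by
  refine (denseRange_toDefect (adjoint (rowOp T.op))).induction (P := fun δ =>
    𝒟.starIso δ ∈ invariantHull 𝒟.V (LinearMap.range 𝒟.emb.toLinearMap)) ?_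
    ((Submodule.isClosed_topologicalClosure _).preimage 𝒟.starIso.continuous) δ
  rintro _ ⟨x, rfl⟩
  rw [starIso_toDefect]
  exact Submodule.sub_mem _ (𝒟.emb_mem_hull _) (Submodule.sum_mem _ fun j _ =>
    map_mem_invariantHull j (𝒟.emb_mem_hull _))

theorem defectShift_mem_hull (f : Fock d T.defect) :
    𝒟.defectShift f ∈ invariantHull 𝒟.V (LinearMap.range 𝒟.emb.toLinearMap) := by
  have hs := (Fock.hasSum_ket f).mapL 𝒟.defectShift.toContinuousLinearMap
  refine (Submodule.isClosed_topologicalClosure _).mem_of_tendsto hs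
    (Filter.Eventually.of_forall fun s => Submodule.sum_mem _ fun α _ => ?_)
  change 𝒟.defectShift (Fock.ket α (f α)) ∈ _
  rw [defectShift_ket]
  exact 𝒟.wordOp_mem_hull (𝒟.defectIso_mem_hull _) α

/-- The `V`-invariant space generated by `H` is `H ⊕ ⨁_α V_α L_T`. -/
theorem range_dilationEmb : LinearMap.range 𝒟.dilationEmb.toLinearMap
    = invariantHull 𝒟.V (LinearMap.range 𝒟.emb.toLinearMap) := by
  refine le_antisymm ?_ (invariantHull_le (isClosed_range_linearIsometry _) ?_ ?_)
  · rintro _ ⟨x, rfl⟩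
    exact Submodule.add_mem _ (𝒟.emb_mem_hull _) (𝒟.defectShift_mem_hull _)
  · rintro _ ⟨h, rfl⟩
    refine ⟨inFst _ _ h, ?_⟩
    change 𝒟.dilationEmb (inFst _ _ h) = 𝒟.emb h
    simp [dilationEmb_apply]
  · rintro j _ ⟨x, rfl⟩
    exact ⟨T.dilationOp j x, 𝒟.dilationEmb_dilationOp j x⟩

theorem exists_eq_of_mem_hull {x : K}
    (hx : x ∈ invariantHull 𝒟.V (LinearMap.range 𝒟.emb.toLinearMap)) :
    ∃ h f, x = 𝒟.emb h + 𝒟.defectShift f := by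
  rw [← range_dilationEmb] at hx
  obtain ⟨y, rfl⟩ := hx
  exact ⟨y.fst, y.snd, rfl⟩

theorem mem_orthogonal_range_emb {x : K} :
    x ∈ (LinearMap.range 𝒟.emb.toLinearMap)ᗮ ↔ ∀ h, inner ℂ (𝒟.emb h) x = 0 := by
  rw [Submodule.mem_orthogonal]
  exact ⟨fun hx h => hx _ ⟨h, rfl⟩, by rintro hx _ ⟨h, rfl⟩; exact hx h⟩

/-- The range of the canonical isometry `D_T → K` is `L_T`. -/
theorem range_defectIso : LinearMap.range 𝒟.defectIso.toLinearMap = 𝒟.wanderingSpace := by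
  apply le_antisymm
  · rintro _ ⟨δ, rfl⟩
    refine ⟨?_, 𝒟.mem_orthogonal_range_emb.2 fun h => 𝒟.inner_emb_defectIso h δ⟩
    refine (denseRange_toDefect (rowOp T.op)).induction (P := fun δ => 𝒟.defectIso δ ∈
      (LinearMap.range 𝒟.emb.toLinearMap ⊔ ⨆ j, (LinearMap.range 𝒟.emb.toLinearMap).map
        (𝒟.V j : K →ₗ[ℂ] K)).topologicalClosure) ?_
      ((Submodule.isClosed_topologicalClosure _).preimage 𝒟.defectIso.continuous) δ
    rintro _ ⟨x, rfl⟩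
    refine Submodule.le_topologicalClosure _ ?_
    rw [defectIso_toDefect]
    refine Submodule.sub_mem _ (Submodule.sum_mem _ fun j _ => ?_) ?_
    · exact Submodule.mem_sup_right (Submodule.mem_iSup_of_mem j ⟨_, ⟨x j, rfl⟩, rfl⟩)
    · exact Submodule.mem_sup_left ⟨_, rfl⟩
  · rintro x ⟨hx, hx'⟩
    let Φ := sumIsometry 𝒟.emb 𝒟.defectIso 𝒟.inner_emb_defectIso
    have hle : (LinearMap.range 𝒟.emb.toLinearMap ⊔
        ⨆ j, (LinearMap.range 𝒟.emb.toLinearMap).map (𝒟.V j : K →ₗ[ℂ] K)).topologicalClosure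
          ≤ LinearMap.range Φ.toLinearMap := by
      refine Submodule.topologicalClosure_minimal _ (sup_le ?_ (iSup_le fun j => ?_))
        (isClosed_range_linearIsometry Φ)
      · rintro _ ⟨h, rfl⟩
        refine ⟨inFst _ _ h, ?_⟩
        change Φ (inFst _ _ h) = 𝒟.emb h
        simp [Φ, sumIsometry_apply]
      · rintro _ ⟨_, ⟨h, rfl⟩, rfl⟩
        refine ⟨WithLp.toLp 2 (T.op j h, toDefect (rowOp T.op) (coord j h)), ?_⟩
        exact (𝒟.V_emb j h).symm
    obtain ⟨y, rfl⟩ := hle hx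
    change 𝒟.emb y.fst + 𝒟.defectIso y.snd ∈ _ at hx'
    change 𝒟.emb y.fst + 𝒟.defectIso y.snd ∈ _
    have h0 := 𝒟.mem_orthogonal_range_emb.1 hx' y.fst
    rw [inner_add_right, 𝒟.inner_emb_defectIso, add_zero, 𝒟.emb.inner_map_map,
      inner_self_eq_zero] at h0
    rw [h0, map_zero, zero_add]
    exact ⟨_, rfl⟩

theorem inner_emb_starIso_toDefect (z x : H) :
    inner ℂ (𝒟.emb z) (𝒟.starIso (toDefect (adjoint (rowOp T.op)) x))
      = inner ℂ z x - inner ℂ (adjoint (rowOp T.op) z) (adjoint (rowOp T.op) x) := by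
  rw [starIso_toDefect, inner_sub_right, inner_sum, 𝒟.emb.inner_map_map, PiLp.inner_apply]
  simp [𝒟.inner_V_emb, adjoint_rowOp, adjoint_inner_left]

theorem inner_starIso_V_of_mem_hull (δ : T.starDefect) (j : Fin d) {x : K}
    (hx : x ∈ invariantHull 𝒟.V (LinearMap.range 𝒟.emb.toLinearMap)) :
    inner ℂ (𝒟.starIso δ) (𝒟.V j x) = 0 := by
  rw [inner_eq_zero_symm, ← adjoint_inner_right]
  refine inner_eq_zero_of_mem_invariantHull hx ?_
  rintro α _ ⟨h, rfl⟩
  rw [adjoint_inner_right, inner_eq_zero_symm]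
  exact 𝒟.inner_starIso_V j α δ h

/-- The range of the canonical isometry `D_{*,T} → K` is `L_{*,T}`. -/
theorem range_starIso : LinearMap.range 𝒟.starIso.toLinearMap = 𝒟.starWanderingSpace := by
  have hsub : ∀ δ, 𝒟.starIso δ ∈ 𝒟.starWanderingSpace := by
    refine fun δ => ⟨𝒟.starIso_mem_hull δ, (Submodule.mem_orthogonal _ _).2 fun y hy => ?_⟩
    have hle : (⨆ j, (invariantHull 𝒟.V (LinearMap.range 𝒟.emb.toLinearMap)).map
        (𝒟.V j : K →ₗ[ℂ] K)) ≤ (ℂ ∙ 𝒟.starIso δ)ᗮ := by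
      refine iSup_le fun j => ?_
      rintro _ ⟨x, hx, rfl⟩
      exact Submodule.mem_orthogonal_singleton_iff_inner_right.2
        (𝒟.inner_starIso_V_of_mem_hull δ j hx)
    exact Submodule.mem_orthogonal_singleton_iff_inner_left.1 (hle hy)
  refine le_antisymm (by rintro _ ⟨δ, rfl⟩; exact hsub δ) fun k hk => ?_
  have hc : IsClosed (LinearMap.range 𝒟.starIso.toLinearMap : Set K) :=
    isClosed_range_linearIsometry _
  have : CompleteSpace (LinearMap.range 𝒟.starIso.toLinearMap) := hc.completeSpace_coe
  -- The part of `k` orthogonal to the range is orthogonal to the hull, in which it lies.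
  obtain ⟨_, ⟨δ, rfl⟩, k', hk', rfl⟩ :=
    (LinearMap.range 𝒟.starIso.toLinearMap).exists_add_mem_mem_orthogonal k
  have hk2 : k' ∈ 𝒟.starWanderingSpace := by
    have := Submodule.sub_mem _ hk (hsub δ)
    rwa [show 𝒟.starIso.toLinearMap δ + k' - 𝒟.starIso δ = k' from add_sub_cancel_left _ _]
      at this
  have hV : ∀ j x, x ∈ invariantHull 𝒟.V (LinearMap.range 𝒟.emb.toLinearMap) →
      inner ℂ (𝒟.V j x) k' = 0 := fun j x hx =>
    (Submodule.mem_orthogonal _ _).1 hk2.2 _ (Submodule.mem_iSup_of_mem j ⟨x, hx, rfl⟩)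
  have hemb : ∀ h, inner ℂ (𝒟.emb h) k' = 0 := by
    intro h
    have h1 := (Submodule.mem_orthogonal _ _).1 hk' _
      ⟨toDefect (adjoint (rowOp T.op)) h, rfl⟩
    change inner ℂ (𝒟.starIso _) k' = 0 at h1
    rw [starIso_toDefect, inner_sub_left, sum_inner,
      Finset.sum_eq_zero fun j _ => hV j _ (𝒟.emb_mem_hull _), sub_zero] at h1
    exact h1
  have h0 : inner ℂ k' k' = 0 := by
    refine inner_eq_zero_of_mem_invariantHull hk2.1 ?_
    rintro α _ ⟨h, rfl⟩
    cases α with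
    | nil => rw [wordOp_nil]; exact hemb h
    | cons j α => rw [wordOp_cons]; exact hV j _ (𝒟.wordOp_mem_hull (𝒟.emb_mem_hull h) α)
  rw [inner_self_eq_zero] at h0
  rw [h0, add_zero]
  exact ⟨δ, rfl⟩

end IsometricDilation

theorem RowContraction.dilation_defectIso (T : RowContraction d H) (δ : T.defect) :
    T.dilation.defectIso δ = inSnd H _ (Fock.ket [] δ) := by
  refine (denseRange_toDefect (rowOp T.op)).induction (P := fun δ =>
    T.dilation.defectIso δ = inSnd H _ (Fock.ket [] δ)) ?_
    (isClosed_eq (by fun_prop) (by fun_prop)) δ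
  rintro _ ⟨x, rfl⟩
  rw [IsometricDilation.defectIso_toDefect, ← sum_coord x]
  simp only [map_sum, rowOp_coord]
  rw [sum_coord, ← Finset.sum_sub_distrib]
  refine Finset.sum_congr rfl fun j _ => ?_
  change T.dilationOp j (inFst _ _ (x j)) - inFst _ _ (T.op j (x j)) = _
  rw [T.dilationOp_apply, sub_eq_iff_eq_add', ← inFst_add_inSnd (WithLp.toLp 2 _)]
  simp

/-- In the minimal isometric dilation `⨁_α V_α L_T` is the summand `Γ ⊗ D_T`. -/
theorem RowContraction.dilation_defectShift (T : RowContraction d H) (f : Fock d T.defect) :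
    T.dilation.defectShift f = inSnd H _ f := by
  have : T.dilation.defectShift.toContinuousLinearMap = (inSnd H _).toContinuousLinearMap := by
    refine Fock.ext_ket fun α δ => ?_
    change T.dilation.defectShift (Fock.ket α δ) = inSnd H _ (Fock.ket α δ)
    rw [IsometricDilation.defectShift_ket, T.dilation_defectIso]
    induction α with
    | nil => rw [wordOp_nil]
    | cons j α ih =>
      rw [wordOp_cons, ih]
      change T.dilationOp j _ = _
      rw [T.dilationOp_apply, ← inFst_add_inSnd (WithLp.toLp 2 _)]
      simp [Fock.creation_ket]
  exact DFunLike.congr_fun this f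

namespace IsometricDilation

variable {T : RowContraction d H} (𝒟 : IsometricDilation T K)

theorem dilationEmb_starIso (δ : T.starDefect) :
    𝒟.dilationEmb (T.dilation.starIso δ) = 𝒟.starIso δ := by
  refine (denseRange_toDefect (adjoint (rowOp T.op))).induction (P := fun δ =>
    𝒟.dilationEmb (T.dilation.starIso δ) = 𝒟.starIso δ) ?_
    (isClosed_eq (by fun_prop) (by fun_prop)) δ
  rintro _ ⟨x, rfl⟩
  have h1 : ∀ y, 𝒟.dilationEmb (T.dilation.emb y) = 𝒟.emb y := by
    intro y
    change 𝒟.dilationEmb (inFst _ _ y) = _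
    simp [dilationEmb_apply]
  have h2 : ∀ j y, 𝒟.dilationEmb (T.dilation.V j y) = 𝒟.V j (𝒟.dilationEmb y) :=
    𝒟.dilationEmb_dilationOp
  simp only [starIso_toDefect, map_sub, map_sum, h1, h2]

theorem dilationEmb_starShift (f : Fock d T.starDefect) :
    𝒟.dilationEmb (T.dilation.starShift f) = 𝒟.starShift f := by
  have : 𝒟.dilationEmb.toContinuousLinearMap.comp T.dilation.starShift.toContinuousLinearMap
      = 𝒟.starShift.toContinuousLinearMap := by
    refine Fock.ext_ket fun α δ => ?_
    change 𝒟.dilationEmb (T.dilation.starShift (Fock.ket α δ)) = 𝒟.starShift (Fock.ket α δ)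
    rw [starShift_ket, starShift_ket]
    exact (𝒟.dilationEmb_wordOp α _).trans (by rw [dilationEmb_starIso])
  exact DFunLike.congr_fun this f

/-- The characteristic function can be computed in any isometric dilation. -/
theorem inner_charFun (g : Fock d T.starDefect) (f : Fock d T.defect) :
    inner ℂ g (T.charFun f) = inner ℂ (𝒟.starShift g) (𝒟.defectShift f) := by
  have h1 : 𝒟.dilationEmb (T.dilation.defectShift f) = 𝒟.defectShift f := by
    rw [T.dilation_defectShift]
    simp [dilationEmb_apply]
  calc inner ℂ g (T.charFun f)
      = inner ℂ (T.dilation.starShift g) (T.dilation.defectShift f) :=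
        adjoint_inner_right T.dilation.starShift.toContinuousLinearMap g (T.dilation.defectShift f)
    _ = inner ℂ (𝒟.dilationEmb (T.dilation.starShift g))
          (𝒟.dilationEmb (T.dilation.defectShift f)) := (𝒟.dilationEmb.inner_map_map _ _).symm
    _ = _ := by rw [h1, 𝒟.dilationEmb_starShift]

end IsometricDilation

/-! ### Completely non-coisometric row contractions -/

/-- For a completely non-coisometric `T`, a set that is invariant under all `T_j*` and on which
`1 - ∑_j T_j T_j*` vanishes contains at most the zero vector: by induction on `n` the sum over
the words of length `n` of `‖T_α* z‖²` stays equal to `‖z‖²`. -/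
theorem RowContraction.IsCNC.eq_zero {T : RowContraction d H} (hT : T.IsCNC) (Z : Set H)
    (hadj : ∀ z ∈ Z, ∀ j, adjoint (T.op j) z ∈ Z)
    (hZ : ∀ z ∈ Z, ‖adjoint (rowOp T.op) z‖ ^ 2 = ‖z‖ ^ 2) {z : H} (hz : z ∈ Z) : z = 0 := by
  refine hT z fun n => ?_
  induction n generalizing z with
  | zero => simp [wordOp, ← ContinuousLinearMap.star_eq_adjoint]
  | succ n ih =>
    rw [← (Fin.consEquiv fun _ : Fin (n + 1) => Fin d).sum_comp, Fintype.sum_prod_type]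
    have h1 : ∀ (j : Fin d) (α : Fin n → Fin d),
        adjoint (wordOp T.op (List.ofFn (Fin.cons j α : Fin (n + 1) → Fin d))) z
          = adjoint (wordOp T.op (List.ofFn α)) (adjoint (T.op j) z) := by
      intro j α
      have : wordOp T.op (List.ofFn (Fin.cons j α : Fin (n + 1) → Fin d))
          = (T.op j).comp (wordOp T.op (List.ofFn α)) := by
        ext x
        rw [List.ofFn_cons, wordOp_cons]
        rfl
      rw [this, ContinuousLinearMap.adjoint_comp]
      rfl
    have h2 : ∀ j, ∑ α : Fin n → Fin d,
        ‖adjoint (wordOp T.op (List.ofFn α)) (adjoint (T.op j) z)‖ ^ 2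
          = ‖adjoint (T.op j) z‖ ^ 2 := fun j => ih (hadj z hz j)
    rw [← hZ z hz, norm_copies_sq]
    refine Finset.sum_congr rfl fun j _ => ?_
    rw [IsometricDilation.adjoint_rowOp, ← h2 j]
    exact Finset.sum_congr rfl fun α _ => congrArg (fun y => ‖y‖ ^ 2) (h1 j α)

end Dilations

/-- Two operators on Fock spaces that are both compressions of the same inner product, seen
through embeddings that differ by ampliations, are carried to each other by these ampliations. -/
theorem map_ampliation_eq_of_inner {d : ℕ} {D D' L L' K : Type*}
    [NormedAddCommGroup D] [InnerProductSpace ℂ D]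
    [NormedAddCommGroup D'] [InnerProductSpace ℂ D'] [CompleteSpace D']
    [NormedAddCommGroup L] [InnerProductSpace ℂ L] [CompleteSpace L]
    [NormedAddCommGroup L'] [InnerProductSpace ℂ L'] [CompleteSpace L']
    [NormedAddCommGroup K] [InnerProductSpace ℂ K]
    {M : Fock d D →L[ℂ] Fock d L} {M' : Fock d D' →L[ℂ] Fock d L'}
    {σ : Fock d L → K} {τ : Fock d D → K} {σ' : Fock d L' → K} {τ' : Fock d D' → K}
    {v : D ≃ₗᵢ[ℂ] D'} {v' : L ≃ₗᵢ[ℂ] L'}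
    (hM : ∀ g f, inner ℂ g (M f) = inner ℂ (σ g) (τ f))
    (hM' : ∀ g f, inner ℂ g (M' f) = inner ℂ (σ' g) (τ' f))
    (hσ : ∀ g, σ' (Fock.ampliation v'.toLinearIsometry g) = σ g)
    (hτ : ∀ f, τ' (Fock.ampliation v.toLinearIsometry f) = τ f) (f : Fock d D) :
    M' (Fock.ampliation v.toLinearIsometry f) = Fock.ampliation v'.toLinearIsometry (M f) := by
  refine ext_inner_left ℂ fun g' => ?_
  obtain ⟨g, rfl⟩ := Fock.ampliation_surjective v' g'
  rw [hM', hσ, hτ, ← hM, LinearIsometry.inner_map_map]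

namespace IsometricDilation

variable {d : ℕ} {H : Type*} {K : Type*}
  [NormedAddCommGroup H] [InnerProductSpace ℂ H] [CompleteSpace H]
  [NormedAddCommGroup K] [InnerProductSpace ℂ K] [CompleteSpace K]
  {T : RowContraction d H}

/-- An isometric dilation is minimal if the `V`-invariant subspace generated by `H` is the whole
space. -/
def IsMinimal (𝒟 : IsometricDilation T K) : Prop :=
  ∀ k, k ∈ invariantHull 𝒟.V (LinearMap.range 𝒟.emb.toLinearMap)

theorem _root_.RowLift.RowContraction.dilation_isMinimal (T : RowContraction d H) :
    T.dilation.IsMinimal := by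
  intro k
  rw [← inFst_add_inSnd k, ← T.dilation_defectShift]
  exact Submodule.add_mem _ (T.dilation.emb_mem_hull k.fst) (T.dilation.defectShift_mem_hull k.snd)

end IsometricDilation

/-! ### Contractive liftings -/

namespace IsLifting

variable {d : ℕ} {HC : Type*} {HA : Type*}
  [NormedAddCommGroup HC] [InnerProductSpace ℂ HC] [CompleteSpace HC]
  [NormedAddCommGroup HA] [InnerProductSpace ℂ HA] [CompleteSpace HA]
  {C : RowContraction d HC} {A : RowContraction d HA}
  {E : RowContraction d (WithLp 2 (HC × HA))}

theorem op_inSnd (h : IsLifting C A E) (j : Fin d) (a : HA) :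
    E.op j (inSnd HC HA a) = inSnd HC HA (A.op j a) := by
  simpa [wordOp] using h.wordOp_inSnd [j] a

theorem op_fst (h : IsLifting C A E) (j : Fin d) (x : WithLp 2 (HC × HA)) :
    (E.op j x).fst = C.op j x.fst := by
  simpa [wordOp] using h.wordOp_fst [j] x

variable {K : Type*} [NormedAddCommGroup K] [InnerProductSpace ℂ K] [CompleteSpace K]
  (h : IsLifting C A E) (𝒟 : IsometricDilation E K)

/-- An isometric dilation of a lifting `E` of `C`, as an isometric dilation of `C`. -/
def overC : IsometricDilation C K where
  V := 𝒟.V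
  emb := 𝒟.emb.comp (inFst HC HA)
  isRowIsometry := 𝒟.isRowIsometry
  dilation := by
    intro α x y
    refine (𝒟.dilation α (inFst HC HA x) (inFst HC HA y)).trans ?_
    rw [inner_inFst_left, h.wordOp_fst, inFst_fst]

/-- An isometric dilation of a lifting `E` with corner `A`, as an isometric dilation of `A`. -/
def overA : IsometricDilation A K where
  V := 𝒟.V
  emb := 𝒟.emb.comp (inSnd HC HA)
  isRowIsometry := 𝒟.isRowIsometry
  dilation := by
    intro α x y
    refine (𝒟.dilation α (inSnd HC HA x) (inSnd HC HA y)).trans ?_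
    rw [h.wordOp_inSnd, LinearIsometry.inner_map_map]

/-- The subspace `H_C` of the dilation space. -/
abbrev spaceC : Submodule ℂ K := LinearMap.range (h.overC 𝒟).emb.toLinearMap

/-- The smallest closed `V`-invariant subspace containing `H_C`. -/
abbrev hullC : Submodule ℂ K := invariantHull 𝒟.V (h.spaceC 𝒟)

/-- The smallest closed `V`-invariant subspace containing `H_A`. -/
abbrev hullA : Submodule ℂ K :=
  invariantHull 𝒟.V (LinearMap.range (h.overA 𝒟).emb.toLinearMap)

theorem embC_add_embA (x : WithLp 2 (HC × HA)) :
    (h.overC 𝒟).emb x.fst + (h.overA 𝒟).emb x.snd = 𝒟.emb x := by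
  change 𝒟.emb (inFst _ _ x.fst) + 𝒟.emb (inSnd _ _ x.snd) = _
  rw [← map_add, inFst_add_inSnd]

theorem inner_embC_embA (c : HC) (a : HA) :
    inner ℂ ((h.overC 𝒟).emb c) ((h.overA 𝒟).emb a) = 0 := by
  refine (𝒟.emb.inner_map_map (inFst _ _ c) (inSnd _ _ a)).trans ?_
  rw [inner_inFst_left, inSnd_fst, inner_zero_right]

theorem inner_embC_defectShift (c : HC) (f : Fock d E.defect) :
    inner ℂ ((h.overC 𝒟).emb c) (𝒟.defectShift f) = 0 :=
  𝒟.inner_emb_defectShift (inFst _ _ c) f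

theorem mem_spaceC_orthogonal_iff {k : K} :
    k ∈ (h.spaceC 𝒟)ᗮ ↔ ∀ c, inner ℂ ((h.overC 𝒟).emb c) k = 0 :=
  (h.overC 𝒟).mem_orthogonal_range_emb

/-- The space `H_C` is invariant under all `V_j*`, and `V_j*` restricts to `C_j*` on it. -/
theorem inner_embC_V (h𝒟 : 𝒟.IsMinimal) (c : HC) (j : Fin d) (k : K) :
    inner ℂ ((h.overC 𝒟).emb c) (𝒟.V j k)
      = inner ℂ ((h.overC 𝒟).emb (adjoint (C.op j) c)) k := by
  obtain ⟨x, f, rfl⟩ := 𝒟.exists_eq_of_mem_hull (h𝒟 k)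
  rw [map_add, inner_add_right, inner_add_right, ← 𝒟.defectShift_creation,
    h.inner_embC_defectShift, h.inner_embC_defectShift]
  congr 1
  refine (𝒟.inner_V_emb j x (inFst _ _ c)).trans ?_
  refine Eq.trans ?_ (𝒟.emb.inner_map_map (inFst _ _ (adjoint (C.op j) c)) x).symm
  rw [inner_inFst_left, inner_inFst_left, h.op_fst, adjoint_inner_left]

theorem exists_eq_of_mem_spaceC_orthogonal (h𝒟 : 𝒟.IsMinimal) {k : K}
    (hk : k ∈ (h.spaceC 𝒟)ᗮ) : ∃ a f, k = (h.overA 𝒟).emb a + 𝒟.defectShift f := by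
  obtain ⟨x, f, rfl⟩ := 𝒟.exists_eq_of_mem_hull (h𝒟 k)
  have h1 := (h.mem_spaceC_orthogonal_iff 𝒟).1 hk x.fst
  rw [← h.embC_add_embA, inner_add_right, inner_add_right, h.inner_embC_embA,
    h.inner_embC_defectShift, LinearIsometry.inner_map_map, add_zero, add_zero,
    inner_self_eq_zero] at h1
  exact ⟨x.snd, f, by rw [← h.embC_add_embA, h1, map_zero, zero_add]⟩

theorem mem_spaceC_orthogonal_of_mem_hullC_orthogonal {k : K} (hk : k ∈ (h.hullC 𝒟)ᗮ) :
    k ∈ (h.spaceC 𝒟)ᗮ :=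
  (h.mem_spaceC_orthogonal_iff 𝒟).2 fun c =>
    (Submodule.mem_orthogonal _ _).1 hk _ ((h.overC 𝒟).emb_mem_hull c)

theorem mem_hullC_orthogonal_iff {k : K} : k ∈ (h.hullC 𝒟)ᗮ ↔
    ∀ α c, inner ℂ (wordOp 𝒟.V α ((h.overC 𝒟).emb c)) k = 0 := by
  rw [Submodule.mem_orthogonal]
  refine ⟨fun hk α c => hk _ (wordOp_mem_invariantHull α ⟨c, rfl⟩), fun hk x hx => ?_⟩
  refine inner_eq_zero_of_mem_invariantHull hx ?_
  rintro α _ ⟨c, rfl⟩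
  exact hk α c

theorem adjoint_V_mem_hullC_orthogonal (j : Fin d) {k : K} (hk : k ∈ (h.hullC 𝒟)ᗮ) :
    adjoint (𝒟.V j) k ∈ (h.hullC 𝒟)ᗮ := by
  rw [Submodule.mem_orthogonal] at hk ⊢
  intro x hx
  rw [adjoint_inner_right]
  exact hk _ (map_mem_invariantHull j hx)

/-- The space `H_C` is invariant under all `V_j*`, hence the `V`-invariant space it generates is
reducing. -/
theorem V_mem_hullC_orthogonal (h𝒟 : 𝒟.IsMinimal) (j : Fin d) {k : K}
    (hk : k ∈ (h.hullC 𝒟)ᗮ) : 𝒟.V j k ∈ (h.hullC 𝒟)ᗮ := by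
  rw [h.mem_hullC_orthogonal_iff] at hk ⊢
  intro α c
  cases α with
  | nil =>
    rw [wordOp_nil, h.inner_embC_V 𝒟 h𝒟]
    simpa [wordOp] using hk [] (adjoint (C.op j) c)
  | cons i α =>
    rw [wordOp_cons, 𝒟.isRowIsometry i j, hk α c, ite_self]

/-- For a minimal lifting, `H_E` contains no vector orthogonal to the space generated by `H_C`. -/
theorem eq_zero_of_mem_hullC_orthogonal (h𝒟 : 𝒟.IsMinimal) (hmin : IsMinimalLifting E) {k : K}
    (hk : k ∈ (h.hullC 𝒟)ᗮ) (hs : ∀ f, inner ℂ k (𝒟.defectShift f) = 0) : k = 0 := by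
  obtain ⟨x, f, rfl⟩ := 𝒟.exists_eq_of_mem_hull (h𝒟 k)
  have hf : f = 0 := by
    have h1 := hs f
    rwa [inner_add_left, 𝒟.inner_emb_defectShift, zero_add, LinearIsometry.inner_map_map,
      inner_self_eq_zero] at h1
  rw [hf, map_zero, add_zero] at hk ⊢
  have hz : ∀ y ∈ {y | ∃ (α : List (Fin d)) (c : HC), y = wordOp E.op α (inFst HC HA c)},
      inner ℂ y x = 0 := by
    rintro _ ⟨α, c, rfl⟩
    rw [inner_eq_zero_symm, ← 𝒟.dilation, inner_eq_zero_symm]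
    exact (h.mem_hullC_orthogonal_iff 𝒟).1 hk α c
  have hle : (⊤ : Submodule ℂ (WithLp 2 (HC × HA))) ≤ (ℂ ∙ x)ᗮ := by
    rw [← hmin]
    refine Submodule.topologicalClosure_minimal _ (Submodule.span_le.2 fun y hy => ?_)
      (Submodule.isClosed_orthogonal _)
    exact Submodule.mem_orthogonal_singleton_iff_inner_left.2 (hz y hy)
  have h0 := Submodule.mem_orthogonal_singleton_iff_inner_left.1 (hle (x := x) trivial)
  rw [inner_self_eq_zero] at h0
  rw [h0, map_zero]

/-- The characteristic function of a lifting, formed in an arbitrary isometric dilation of `E`. -/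
def charFunOf : Fock d E.defect →L[ℂ] Fock d C.defect :=
  (adjoint (h.overC 𝒟).defectShift.toContinuousLinearMap).comp
    𝒟.defectShift.toContinuousLinearMap

theorem inner_charFunOf (g : Fock d C.defect) (f : Fock d E.defect) :
    inner ℂ g (h.charFunOf 𝒟 f) = inner ℂ ((h.overC 𝒟).defectShift g) (𝒟.defectShift f) :=
  adjoint_inner_right (h.overC 𝒟).defectShift.toContinuousLinearMap g (𝒟.defectShift f)

/-- The characteristic function of a lifting is purely contractive if and only if
`L_E ∩ L_C = 0`: a vector of `L_E` whose projection to `L_C` has the same norm lies in `L_C`. -/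
theorem isPurelyContractive_iff : IsPurelyContractive (h.charFunOf 𝒟) ↔
    ∀ δ, 𝒟.defectIso δ ∈ (h.overC 𝒟).wanderingSpace → δ = 0 := by
  -- The vacuum component of the symbol.
  obtain ⟨s, hs⟩ : ∃ s : E.defect → C.defect, ∀ δ, symbol (h.charFunOf 𝒟) δ [] = s δ :=
    ⟨_, fun _ => rfl⟩
  have hin : ∀ (η : C.defect) (δ : E.defect), inner ℂ η (s δ)
      = inner ℂ ((h.overC 𝒟).defectIso η) (𝒟.defectIso δ) := by
    intro η δ
    have h1 := h.inner_charFunOf 𝒟 (Fock.ket [] η) (Fock.ket [] δ)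
    rw [IsometricDilation.defectShift_ket, IsometricDilation.defectShift_ket, wordOp_nil,
      wordOp_nil, Fock.inner_ket_left] at h1
    exact (congrArg (inner ℂ η) (hs δ).symm).trans h1
  have key : ∀ δ, ‖δ‖ ≤ ‖s δ‖ → (h.overC 𝒟).defectIso (s δ) = 𝒟.defectIso δ := by
    intro δ hδ
    have h1 : ‖(h.overC 𝒟).defectIso (s δ) - 𝒟.defectIso δ‖ ^ 2 = ‖δ‖ ^ 2 - ‖s δ‖ ^ 2 := by
      rw [@norm_sub_sq ℂ, ← hin, inner_self_eq_norm_sq, LinearIsometry.norm_map,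
        LinearIsometry.norm_map]
      ring
    have h2 : ‖δ‖ ^ 2 ≤ ‖s δ‖ ^ 2 := by gcongr
    rw [← sub_eq_zero, ← norm_eq_zero, ← sq_eq_zero_iff]
    exact le_antisymm (by linarith) (sq_nonneg _)
  have hpure : IsPurelyContractive (h.charFunOf 𝒟) ↔ ∀ δ, δ ≠ 0 → ‖s δ‖ < ‖δ‖ := by
    unfold IsPurelyContractive
    simp only [LinearIsometry.norm_map, hs]
  rw [hpure, ← IsometricDilation.range_defectIso]
  constructor
  · rintro hp δ ⟨η, hη⟩
    change (h.overC 𝒟).defectIso η = _ at hη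
    by_contra hδ
    have h1 : s δ = η := by
      refine ext_inner_left ℂ fun ζ => ?_
      rw [hin, ← hη, LinearIsometry.inner_map_map]
    have h2 := hp δ hδ
    rw [h1, ← (h.overC 𝒟).defectIso.norm_map η, hη, LinearIsometry.norm_map] at h2
    exact lt_irrefl _ h2
  · intro hp δ hδ
    by_contra hn
    exact hδ (hp δ ⟨_, key δ (not_lt.1 hn)⟩)

theorem norm_charFunOf_le (f : Fock d E.defect) : ‖h.charFunOf 𝒟 f‖ ≤ ‖f‖ := by
  have h2 : ‖h.charFunOf 𝒟 f‖ ^ 2 ≤ ‖h.charFunOf 𝒟 f‖ * ‖f‖ := by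
    rw [← inner_self_eq_norm_sq (𝕜 := ℂ), h.inner_charFunOf]
    refine (re_inner_le_norm _ _).trans ?_
    rw [LinearIsometry.norm_map, LinearIsometry.norm_map]
  by_contra hlt
  nlinarith [norm_nonneg f]

/-- The residual map `f ↦ (1 - P) f` on `⨁_α V_α L_E`, where `P` is the projection onto
`⨁_α V_α L_C`. It has the same norms as the defect operator of the characteristic function. -/
def residual : Fock d E.defect →L[ℂ] K :=
  𝒟.defectShift.toContinuousLinearMap
    - (h.overC 𝒟).defectShift.toContinuousLinearMap.comp (h.charFunOf 𝒟)

theorem residual_apply (f : Fock d E.defect) : h.residual 𝒟 f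
    = 𝒟.defectShift f - (h.overC 𝒟).defectShift (h.charFunOf 𝒟 f) := rfl

theorem norm_residual (f : Fock d E.defect) :
    ‖h.residual 𝒟 f‖ = ‖defectOp (h.charFunOf 𝒟) f‖ := by
  rw [← sq_eq_sq₀ (norm_nonneg _) (norm_nonneg _), norm_defectOp_sq _ (h.norm_charFunOf_le 𝒟),
    residual_apply, norm_sub_rev, @norm_sub_sq ℂ, ← h.inner_charFunOf, inner_self_eq_norm_sq,
    LinearIsometry.norm_map, LinearIsometry.norm_map]
  ring

theorem residual_mem (f : Fock d E.defect) : h.residual 𝒟 f ∈ (h.hullC 𝒟)ᗮ := by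
  rw [Submodule.mem_orthogonal]
  intro x hx
  obtain ⟨c, g, rfl⟩ := (h.overC 𝒟).exists_eq_of_mem_hull hx
  rw [residual_apply, inner_add_left, inner_sub_right, inner_sub_right,
    h.inner_embC_defectShift, (h.overC 𝒟).inner_emb_defectShift, ← h.inner_charFunOf,
    LinearIsometry.inner_map_map]
  simp

theorem inner_residual {k : K} (hk : k ∈ (h.hullC 𝒟)ᗮ) (f : Fock d E.defect) :
    inner ℂ k (h.residual 𝒟 f) = inner ℂ k (𝒟.defectShift f) := by
  rw [residual_apply, inner_sub_right, (Submodule.mem_orthogonal' _ _).1 hk _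
    ((h.overC 𝒟).defectShift_mem_hull _), sub_zero]

theorem exists_hullC_add (k : K) :
    ∃ p ∈ h.hullC 𝒟, ∃ n ∈ (h.hullC 𝒟)ᗮ, k = p + n := by
  have hcl : IsClosed (h.hullC 𝒟 : Set K) := Submodule.isClosed_topologicalClosure _
  have : CompleteSpace (h.hullC 𝒟) := hcl.completeSpace_coe
  exact (h.hullC 𝒟).exists_add_mem_mem_orthogonal k

theorem szegoCondition_iff_residual : SzegoCondition (h.charFunOf 𝒟) ↔
    (LinearMap.range (h.residual 𝒟 : Fock d E.defect →ₗ[ℂ] K)).topologicalClosure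
      = ((Fock.vacuum d E.defect)ᗮ.map
        (h.residual 𝒟 : Fock d E.defect →ₗ[ℂ] K)).topologicalClosure := by
  unfold SzegoCondition
  rw [range_closure_eq_map_closure_iff, range_closure_eq_map_closure_iff]
  simp only [ContinuousLinearMap.coe_coe, norm_residual]

/-- For a minimal lifting, the Szegő condition says that `V` restricted to the orthogonal
complement of the space generated by `H_C` is a row unitary, i.e. has no wandering vectors. -/
theorem szegoCondition_iff (h𝒟 : 𝒟.IsMinimal) (hmin : IsMinimalLifting E) :
    SzegoCondition (h.charFunOf 𝒟) ↔
      ∀ k ∈ (h.hullC 𝒟)ᗮ, (∀ j y, inner ℂ k (𝒟.V j y) = 0) → k = 0 := by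
  rw [szegoCondition_iff_residual]
  constructor
  · intro hS k hk hV
    refine h.eq_zero_of_mem_hullC_orthogonal 𝒟 h𝒟 hmin hk fun f => ?_
    rw [← h.inner_residual 𝒟 hk]
    have hle : ((Fock.vacuum d E.defect)ᗮ.map
        (h.residual 𝒟 : Fock d E.defect →ₗ[ℂ] K)).topologicalClosure ≤ (ℂ ∙ k)ᗮ := by
      refine Submodule.topologicalClosure_minimal _ ?_ (Submodule.isClosed_orthogonal _)
      rintro _ ⟨s, hs, rfl⟩
      rw [Submodule.mem_orthogonal_singleton_iff_inner_right]
      refine (h.inner_residual 𝒟 hk s).trans ?_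
      refine Fock.map_eq_zero_of_creation (((innerSL ℂ) k).comp
        𝒟.defectShift.toContinuousLinearMap) (fun j g => ?_)
        ((Fock.mem_vacuum_orthogonal s).1 hs)
      change inner ℂ k (𝒟.defectShift (Fock.creation j g)) = 0
      rw [𝒟.defectShift_creation]
      exact hV j _
    have hmem : h.residual 𝒟 f ∈ (LinearMap.range
        (h.residual 𝒟 : Fock d E.defect →ₗ[ℂ] K)).topologicalClosure :=
      Submodule.le_topologicalClosure _ ⟨f, rfl⟩
    rw [hS] at hmem
    exact Submodule.mem_orthogonal_singleton_iff_inner_right.1 (hle hmem)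
  · intro hV
    refine le_antisymm ?_ (Submodule.topologicalClosure_mono
      (by rintro _ ⟨s, -, rfl⟩; exact ⟨s, rfl⟩))
    refine Submodule.topologicalClosure_minimal _ ?_ (Submodule.isClosed_topologicalClosure _)
    rintro _ ⟨f, rfl⟩
    rw [← Submodule.orthogonal_orthogonal_eq_closure, Submodule.mem_orthogonal]
    intro k hk
    -- Only the component `n` of `k` in the complement of the hull matters; all `V_j* n` vanish.
    obtain ⟨p, hp, n, hn, rfl⟩ := h.exists_hullC_add 𝒟 k
    have hpn : ∀ f, inner ℂ (p + n) (h.residual 𝒟 f) = inner ℂ n (𝒟.defectShift f) := by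
      intro f
      rw [inner_add_left, (Submodule.mem_orthogonal _ _).1 (h.residual_mem 𝒟 f) _ hp, zero_add,
        h.inner_residual 𝒟 hn]
    have hadj : ∀ j, adjoint (𝒟.V j) n = 0 := by
      intro j
      refine h.eq_zero_of_mem_hullC_orthogonal 𝒟 h𝒟 hmin
        (h.adjoint_V_mem_hullC_orthogonal 𝒟 j hn) fun g => ?_
      rw [adjoint_inner_left, ← 𝒟.defectShift_creation, ← hpn]
      exact (Submodule.mem_orthogonal' _ _).1 hk _
        ⟨_, Fock.creation_mem_vacuum_orthogonal j g, rfl⟩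
    have h0 : n = 0 := hV n hn fun j y => by
      rw [← adjoint_inner_left, hadj, inner_zero_left]
    refine (hpn f).trans ?_
    rw [h0, inner_zero_left]

theorem overA_defectIso_coord (j : Fin d) (a : HA) :
    (h.overA 𝒟).defectIso (toDefect (rowOp A.op) (coord j a))
      = 𝒟.defectIso (toDefect (rowOp E.op) (coord j (inSnd HC HA a))) := by
  have h1 := (h.overA 𝒟).V_emb j a
  have h2 := 𝒟.V_emb j (inSnd HC HA a)
  rw [h.op_inSnd] at h2
  exact add_left_cancel (h1.symm.trans h2)

theorem wanderingSpace_overA_le : (h.overA 𝒟).wanderingSpace ≤ 𝒟.wanderingSpace := by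
  rw [← IsometricDilation.range_defectIso, ← IsometricDilation.range_defectIso]
  rintro _ ⟨δ, rfl⟩
  refine (denseRange_toDefect (rowOp A.op)).induction (P := fun δ => (h.overA 𝒟).defectIso δ ∈
    LinearMap.range 𝒟.defectIso.toLinearMap) ?_
    ((isClosed_range_linearIsometry _).preimage (h.overA 𝒟).defectIso.continuous) δ
  rintro _ ⟨x, rfl⟩
  rw [← sum_coord x, map_sum, map_sum]
  refine Submodule.sum_mem _ fun j _ => ?_
  rw [h.overA_defectIso_coord]
  exact ⟨_, rfl⟩

/-- To prove `L_E = L_A` it suffices to show that `L_E ⊖ L_A` is zero. -/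
theorem wanderingSpace_eq_of_forall
    (h0 : ∀ δ, (∀ η, inner ℂ ((h.overA 𝒟).defectIso η) (𝒟.defectIso δ) = 0) → δ = 0) :
    𝒟.wanderingSpace = (h.overA 𝒟).wanderingSpace := by
  refine le_antisymm ?_ (h.wanderingSpace_overA_le 𝒟)
  have hle := h.wanderingSpace_overA_le 𝒟
  rw [← IsometricDilation.range_defectIso, ← IsometricDilation.range_defectIso] at hle ⊢
  rintro _ ⟨δ, rfl⟩
  have hc : IsClosed (LinearMap.range (h.overA 𝒟).defectIso.toLinearMap : Set K) :=
    isClosed_range_linearIsometry _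
  have : CompleteSpace (LinearMap.range (h.overA 𝒟).defectIso.toLinearMap) :=
    hc.completeSpace_coe
  obtain ⟨_, ⟨η, rfl⟩, r, hr, hsum⟩ :=
    (LinearMap.range (h.overA 𝒟).defectIso.toLinearMap).exists_add_mem_mem_orthogonal
      (𝒟.defectIso δ)
  obtain ⟨η', hη'⟩ := hle ⟨η, rfl⟩
  have hrE : 𝒟.defectIso (δ - η') = r := by
    rw [map_sub, hsum]
    exact sub_eq_of_eq_add' (by rw [← hη']; rfl)
  have hz : δ - η' = 0 := h0 _ fun ζ => by
    rw [hrE]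
    exact (Submodule.mem_orthogonal _ _).1 hr _ ⟨ζ, rfl⟩
  rw [sub_eq_zero.1 hz]
  exact ⟨η, hη'.symm⟩

theorem inner_defectIso_V_defectShift (δ : E.defect) (j : Fin d) (f : Fock d E.defect) :
    inner ℂ (𝒟.defectIso δ) (𝒟.V j (𝒟.defectShift f)) = 0 := by
  have h1 : 𝒟.defectIso δ = 𝒟.defectShift (Fock.ket [] δ) := by
    rw [IsometricDilation.defectShift_ket, wordOp_nil]
  rw [h1, ← 𝒟.defectShift_creation, LinearIsometry.inner_map_map]
  exact (Submodule.mem_orthogonal _ _).1 (Fock.creation_mem_vacuum_orthogonal j f) _ ⟨δ, rfl⟩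

/-- A vector of `L_E ⊖ L_A` is orthogonal to `V_j y` for every `y` orthogonal to `H_C`. -/
theorem inner_defectIso_V_eq_zero (h𝒟 : 𝒟.IsMinimal) {δ : E.defect}
    (hδ : ∀ η, inner ℂ ((h.overA 𝒟).defectIso η) (𝒟.defectIso δ) = 0)
    (j : Fin d) {y : K} (hy : y ∈ (h.spaceC 𝒟)ᗮ) :
    inner ℂ (𝒟.defectIso δ) (𝒟.V j y) = 0 := by
  obtain ⟨a, f, rfl⟩ := h.exists_eq_of_mem_spaceC_orthogonal 𝒟 h𝒟 hy
  have hV : 𝒟.V j ((h.overA 𝒟).emb a) = _ := (h.overA 𝒟).V_emb j a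
  have hA : inner ℂ (𝒟.defectIso δ) ((h.overA 𝒟).emb (A.op j a)) = 0 :=
    inner_eq_zero_symm.1 (𝒟.inner_emb_defectIso (inSnd _ _ (A.op j a)) δ)
  rw [map_add, inner_add_right, inner_defectIso_V_defectShift, add_zero, hV, inner_add_right, hA,
    inner_eq_zero_symm.1 (hδ _), add_zero]

theorem hullA_le_spaceC_orthogonal : h.hullA 𝒟 ≤ (h.spaceC 𝒟)ᗮ := by
  intro y hy
  rw [h.mem_spaceC_orthogonal_iff]
  intro c
  rw [inner_eq_zero_symm]
  refine inner_eq_zero_of_mem_invariantHull hy ?_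
  rintro α _ ⟨a, rfl⟩
  rw [inner_eq_zero_symm]
  refine (𝒟.dilation α (inSnd HC HA a) (inFst HC HA c)).trans ?_
  rw [h.wordOp_inSnd, inner_inFst_left, inSnd_fst, inner_zero_right]

/-- If `L_E = L_A`, the space generated by `H_A` is the orthogonal complement of `H_C`. -/
theorem hullA_eq (h𝒟 : 𝒟.IsMinimal)
    (hL : 𝒟.wanderingSpace = (h.overA 𝒟).wanderingSpace) : h.hullA 𝒟 = (h.spaceC 𝒟)ᗮ := by
  refine le_antisymm (h.hullA_le_spaceC_orthogonal 𝒟) fun y hy => ?_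
  rw [← IsometricDilation.range_defectIso, ← IsometricDilation.range_defectIso] at hL
  obtain ⟨u, hu⟩ := exists_unitary_of_range_eq _ _ hL
  obtain ⟨a, f, rfl⟩ := h.exists_eq_of_mem_spaceC_orthogonal 𝒟 h𝒟 hy
  have h1 : 𝒟.defectShift f
      = (h.overA 𝒟).defectShift (Fock.ampliation u.toLinearIsometry f) :=
    (shiftEmb_ampliation _ _ _ _ _ u.toLinearIsometry hu f).symm
  rw [h1]
  exact Submodule.add_mem _ ((h.overA 𝒟).emb_mem_hull _) ((h.overA 𝒟).defectShift_mem_hull _)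

/-- The space `L_C` is orthogonal to `V_j y` for every `y` orthogonal to `H_C`. -/
theorem inner_overC_defectIso_V (h𝒟 : 𝒟.IsMinimal) (δ : C.defect) (j : Fin d) {y : K}
    (hy : y ∈ (h.spaceC 𝒟)ᗮ) : inner ℂ ((h.overC 𝒟).defectIso δ) (𝒟.V j y) = 0 := by
  rw [h.mem_spaceC_orthogonal_iff] at hy
  refine (denseRange_toDefect (rowOp C.op)).induction (P := fun δ =>
    inner ℂ ((h.overC 𝒟).defectIso δ) (𝒟.V j y) = 0) ?_
    (isClosed_eq (by fun_prop) (by fun_prop)) δ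
  rintro _ ⟨x, rfl⟩
  rw [IsometricDilation.defectIso_toDefect, inner_sub_left, sum_inner, h.inner_embC_V 𝒟 h𝒟, hy,
    sub_zero]
  refine Finset.sum_eq_zero fun i _ => ?_
  refine (𝒟.isRowIsometry i j _ y).trans ?_
  rw [hy, ite_self]

/-- If `L_E = L_A`, then `L_{*,A} = Y ⊖ ⨁_j V_j Y` with `Y` the orthogonal complement of `H_C`. -/
theorem mem_starWanderingSpace_iff (h𝒟 : 𝒟.IsMinimal)
    (hL : 𝒟.wanderingSpace = (h.overA 𝒟).wanderingSpace)
    {y : K} : y ∈ (h.overA 𝒟).starWanderingSpace ↔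
      y ∈ (h.spaceC 𝒟)ᗮ ∧ ∀ j, ∀ z ∈ (h.spaceC 𝒟)ᗮ, inner ℂ y (𝒟.V j z) = 0 := by
  have h1 : y ∈ (h.overA 𝒟).starWanderingSpace ↔ y ∈ h.hullA 𝒟 ∧
      y ∈ (⨆ j, (h.hullA 𝒟).map (𝒟.V j : K →ₗ[ℂ] K))ᗮ := Iff.rfl
  rw [h1, h.hullA_eq 𝒟 h𝒟 hL, Submodule.mem_orthogonal' (⨆ j, _)]
  refine and_congr_right fun _ => ⟨fun hy j z hz => ?_, fun hy x hx => ?_⟩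
  · exact hy _ (Submodule.mem_iSup_of_mem j ⟨z, hz, rfl⟩)
  · have hle : (⨆ j, (h.spaceC 𝒟)ᗮ.map (𝒟.V j : K →ₗ[ℂ] K)) ≤ (ℂ ∙ y)ᗮ := by
      refine iSup_le fun j => ?_
      rintro _ ⟨z, hz, rfl⟩
      exact Submodule.mem_orthogonal_singleton_iff_inner_right.2 (hy j z hz)
    exact Submodule.mem_orthogonal_singleton_iff_inner_right.1 (hle hx)

/-- If `V` has no wandering vectors on the complement of the space generated by `H_C`, then with
`Y` the orthogonal complement of `H_C` the space `Y ⊖ ⨁_j V_j Y` is contained in `L_C`. -/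
theorem mem_wanderingSpace_overC (h𝒟 : 𝒟.IsMinimal)
    (hS : ∀ k ∈ (h.hullC 𝒟)ᗮ, (∀ j y, inner ℂ k (𝒟.V j y) = 0) → k = 0)
    {y : K} (hy : y ∈ (h.spaceC 𝒟)ᗮ)
    (hyV : ∀ j, ∀ z ∈ (h.spaceC 𝒟)ᗮ, inner ℂ y (𝒟.V j z) = 0) :
    y ∈ (h.overC 𝒟).wanderingSpace := by
  obtain ⟨p, hp, n, hn, rfl⟩ := h.exists_hullC_add 𝒟 y
  have hn0 : n = 0 := by
    refine hS n hn fun j z => ?_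
    obtain ⟨q, hq, m, hm, rfl⟩ := h.exists_hullC_add 𝒟 z
    have h1 := hyV j m (h.mem_spaceC_orthogonal_of_mem_hullC_orthogonal 𝒟 hm)
    rw [inner_add_left, (Submodule.mem_orthogonal _ _).1
      (h.V_mem_hullC_orthogonal 𝒟 h𝒟 j hm) _ hp, zero_add] at h1
    rw [map_add, inner_add_right, h1, (Submodule.mem_orthogonal' _ _).1 hn _
      (map_mem_invariantHull j hq), add_zero]
  rw [hn0, add_zero] at hy hyV ⊢
  obtain ⟨c, f, rfl⟩ := (h.overC 𝒟).exists_eq_of_mem_hull hp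
  have hc : c = 0 := by
    have h1 := (h.mem_spaceC_orthogonal_iff 𝒟).1 hy c
    rwa [inner_add_right, (h.overC 𝒟).inner_emb_defectShift, add_zero,
      LinearIsometry.inner_map_map, inner_self_eq_zero] at h1
  rw [hc, map_zero, zero_add] at hyV ⊢
  have hf : f = Fock.ket [] (f []) := Fock.eq_ket_nil_of_inner_creation fun j g => by
    rw [← (h.overC 𝒟).defectShift.inner_map_map, (h.overC 𝒟).defectShift_creation]
    exact hyV j _ ((h.mem_spaceC_orthogonal_iff 𝒟).2
      fun c => (h.overC 𝒟).inner_emb_defectShift c g)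
  rw [hf, IsometricDilation.defectShift_ket, wordOp_nil, ← IsometricDilation.range_defectIso]
  exact ⟨_, rfl⟩

theorem wanderingSpace_overC_le_hullC : (h.overC 𝒟).wanderingSpace ≤ h.hullC 𝒟 := by
  rw [← IsometricDilation.range_defectIso]
  rintro _ ⟨δ, rfl⟩
  exact (h.overC 𝒟).defectIso_mem_hull δ

/-- The characterization of `L_E = L_A` and `L_C = L_{*,A}`, formed in an arbitrary minimal isometric
dilation of `E`. -/
theorem purelyContractive_and_szego_iff_of_isMinimal (h𝒟 : 𝒟.IsMinimal)
    (hmin : IsMinimalLifting E) :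
    (IsPurelyContractive (h.charFunOf 𝒟) ∧ SzegoCondition (h.charFunOf 𝒟)) ↔
      (𝒟.wanderingSpace = (h.overA 𝒟).wanderingSpace ∧
        (h.overC 𝒟).wanderingSpace = (h.overA 𝒟).starWanderingSpace) := by
  rw [h.isPurelyContractive_iff, h.szegoCondition_iff 𝒟 h𝒟 hmin]
  constructor
  · rintro ⟨hP, hS⟩
    have hL : 𝒟.wanderingSpace = (h.overA 𝒟).wanderingSpace := by
      refine h.wanderingSpace_eq_of_forall 𝒟 fun δ hδ => hP δ ?_
      exact h.mem_wanderingSpace_overC 𝒟 h𝒟 hS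
        ((h.mem_spaceC_orthogonal_iff 𝒟).2 fun c => 𝒟.inner_emb_defectIso (inFst _ _ c) δ)
        fun j z hz => h.inner_defectIso_V_eq_zero 𝒟 h𝒟 hδ j hz
    refine ⟨hL, le_antisymm ?_ fun y hy => ?_⟩
    · rw [← IsometricDilation.range_defectIso]
      rintro _ ⟨δ, rfl⟩
      exact (h.mem_starWanderingSpace_iff 𝒟 h𝒟 hL).2 ⟨(h.mem_spaceC_orthogonal_iff 𝒟).2
          fun c => (h.overC 𝒟).inner_emb_defectIso c δ,
        fun j z hz => h.inner_overC_defectIso_V 𝒟 h𝒟 δ j hz⟩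
    · obtain ⟨h1, h2⟩ := (h.mem_starWanderingSpace_iff 𝒟 h𝒟 hL).1 hy
      exact h.mem_wanderingSpace_overC 𝒟 h𝒟 hS h1 h2
  · rintro ⟨hL, hLC⟩
    constructor
    · intro δ hδ
      rw [hLC] at hδ
      have h1 : ∀ α, ∀ s ∈ LinearMap.range (h.overA 𝒟).emb.toLinearMap,
          inner ℂ (wordOp 𝒟.V α s) (𝒟.defectIso δ) = 0 := by
        rintro α _ ⟨a, rfl⟩
        cases α with
        | nil => rw [wordOp_nil]; exact 𝒟.inner_emb_defectIso (inSnd _ _ a) δ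
        | cons j α =>
          rw [wordOp_cons, inner_eq_zero_symm]
          exact ((h.mem_starWanderingSpace_iff 𝒟 h𝒟 hL).1 hδ).2 j _
            (h.hullA_le_spaceC_orthogonal 𝒟 (wordOp_mem_invariantHull α ⟨a, rfl⟩))
      have h0 := inner_eq_zero_of_mem_invariantHull hδ.1 h1
      rw [inner_self_eq_zero] at h0
      exact 𝒟.defectIso.injective (by rw [h0, map_zero])
    · intro k hk hV
      have h1 : k ∈ (h.overC 𝒟).wanderingSpace := by
        rw [hLC, h.mem_starWanderingSpace_iff 𝒟 h𝒟 hL]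
        exact ⟨h.mem_spaceC_orthogonal_of_mem_hullC_orthogonal 𝒟 hk, fun j z _ => hV j z⟩
      have h0 := (Submodule.mem_orthogonal _ _).1 hk k (h.wanderingSpace_overC_le_hullC 𝒟 h1)
      rwa [inner_self_eq_zero] at h0

theorem dilationC_eq : h.dilationC = h.overC E.dilation := rfl

theorem dilationA_eq : h.dilationA = h.overA E.dilation := rfl

theorem charFun_eq : h.charFun = h.charFunOf E.dilation := rfl

theorem purelyContractive_and_szego_iff (hmin : IsMinimalLifting E) :
    (IsPurelyContractive h.charFun ∧ SzegoCondition h.charFun) ↔ h.SpacesAgree := by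
  rw [charFun_eq, SpacesAgree, dilationC_eq, dilationA_eq]
  exact h.purelyContractive_and_szego_iff_of_isMinimal E.dilation E.dilation_isMinimal hmin

theorem exists_charFun_eq_of_spaces_agree
    (h1 : 𝒟.wanderingSpace = (h.overA 𝒟).wanderingSpace)
    (h2 : (h.overC 𝒟).wanderingSpace = (h.overA 𝒟).starWanderingSpace) :
    ∃ (u : E.defect ≃ₗᵢ[ℂ] A.defect) (u' : C.defect ≃ₗᵢ[ℂ] A.starDefect),
      (∀ δ, (h.overA 𝒟).defectIso (u δ) = 𝒟.defectIso δ) ∧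
      (∀ δ, (h.overA 𝒟).starIso (u' δ) = (h.overC 𝒟).defectIso δ) ∧
      ∀ f, A.charFun (Fock.ampliation u.toLinearIsometry f) =
        Fock.ampliation u'.toLinearIsometry (h.charFunOf 𝒟 f) := by
  rw [← IsometricDilation.range_defectIso, ← IsometricDilation.range_defectIso] at h1
  rw [← IsometricDilation.range_defectIso, ← IsometricDilation.range_starIso] at h2
  obtain ⟨u, hu⟩ := exists_unitary_of_range_eq _ _ h1
  obtain ⟨u', hu'⟩ := exists_unitary_of_range_eq _ _ h2
  exact ⟨u, u', hu, hu', map_ampliation_eq_of_inner (h.inner_charFunOf 𝒟)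
    (h.overA 𝒟).inner_charFun
    (shiftEmb_ampliation _ _ _ _ _ u'.toLinearIsometry hu')
    (shiftEmb_ampliation _ _ _ _ _ u.toLinearIsometry hu)⟩

theorem SpacesAgree.charFunEqPopescu {h : IsLifting C A E} (hs : h.SpacesAgree) :
    h.CharFunEqPopescu := by
  rw [SpacesAgree, dilationC_eq, dilationA_eq] at hs
  unfold CharFunEqPopescu
  rw [dilationC_eq, dilationA_eq, charFun_eq]
  exact h.exists_charFun_eq_of_spaces_agree E.dilation hs.1 hs.2

end IsLifting

/-! ### Construction of a lifting with prescribed corners -/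

section Construction

variable {d : ℕ} {HC : Type*} {HA : Type*}
  [NormedAddCommGroup HC] [InnerProductSpace ℂ HC] [CompleteSpace HC]
  [NormedAddCommGroup HA] [InnerProductSpace ℂ HA] [CompleteSpace HA]
  {C : RowContraction d HC} {A : RowContraction d HA}

theorem inner_defectOp_left {X Y : Type*}
    [NormedAddCommGroup X] [InnerProductSpace ℂ X] [CompleteSpace X]
    [NormedAddCommGroup Y] [InnerProductSpace ℂ Y] [CompleteSpace Y] (S : X →L[ℂ] Y)
    (e : defectSpace S) (x : X) : inner ℂ (defectOp S e) x = inner ℂ e (toDefect S x) := by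
  rw [← adjoint_inner_right, adjoint_defectOp]
  rfl

/-- The row operator `(D_{*,A}, A)` is a coisometry, hence contractive. -/
theorem RowContraction.norm_defectOp_add_le (A : RowContraction d HA) (e : A.starDefect)
    (y : Copies d HA) :
    ‖defectOp (adjoint (rowOp A.op)) e + rowOp A.op y‖ ^ 2 ≤ ‖e‖ ^ 2 + ‖y‖ ^ 2 := by
  set v := defectOp (adjoint (rowOp A.op)) e + rowOp A.op y with hv
  have h1 := norm_defectOp_sq _ A.norm_adjoint_rowOp_le v
  have h2 : inner ℂ v v = inner ℂ e (toDefect (adjoint (rowOp A.op)) v)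
      + inner ℂ y (adjoint (rowOp A.op) v) := by
    conv_lhs => enter [2]; rw [hv]
    rw [inner_add_left, inner_defectOp_left, adjoint_inner_right]
  have h3 : ‖v‖ ^ 2 ≤ ‖e‖ * ‖defectOp (adjoint (rowOp A.op)) v‖
      + ‖y‖ * ‖adjoint (rowOp A.op) v‖ := by
    rw [← inner_self_eq_norm_sq (𝕜 := ℂ), h2, map_add]
    exact add_le_add (re_inner_le_norm e (toDefect (adjoint (rowOp A.op)) v))
      (re_inner_le_norm y (adjoint (rowOp A.op) v))
  nlinarith [sq_nonneg (‖e‖ - ‖defectOp (adjoint (rowOp A.op)) v‖),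
    sq_nonneg (‖y‖ - ‖adjoint (rowOp A.op) v‖)]

/-- The operators `E_j = (C_j, 0; B_j, A_j)` on `H_C ⊕ H_A` with `B = D_{*,A} w D_C`, for an
isometry `w : D_C → D_{*,A}`. -/
def couplingOp (w : C.defect →ₗᵢ[ℂ] A.starDefect) (j : Fin d) :
    WithLp 2 (HC × HA) →L[ℂ] WithLp 2 (HC × HA) :=
  (inFst HC HA).toContinuousLinearMap.comp ((C.op j).comp (WithLp.fstL 2 ℂ HC HA))
    + (inSnd HC HA).toContinuousLinearMap.comp
      (((defectOp (adjoint (rowOp A.op))).comp (A.starDefect.subtypeL.comp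
        (w.toContinuousLinearMap.comp ((toDefect (rowOp C.op)).comp
          ((coord j).toContinuousLinearMap.comp (WithLp.fstL 2 ℂ HC HA))))))
        + (A.op j).comp (WithLp.sndL 2 ℂ HC HA))

theorem couplingOp_apply (w : C.defect →ₗᵢ[ℂ] A.starDefect) (j : Fin d)
    (x : WithLp 2 (HC × HA)) : couplingOp w j x = inFst HC HA (C.op j x.fst)
      + inSnd HC HA (defectOp (adjoint (rowOp A.op)) (w (toDefect (rowOp C.op) (coord j x.fst)))
        + A.op j x.snd) := rfl

theorem norm_rowOp_couplingOp_le (w : C.defect →ₗᵢ[ℂ] A.starDefect)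
    (ξ : Copies d (WithLp 2 (HC × HA))) : ‖rowOp (couplingOp w) ξ‖ ≤ ‖ξ‖ := by
  let x : Copies d HC := WithLp.toLp 2 fun j => (ξ j).fst
  let y : Copies d HA := WithLp.toLp 2 fun j => (ξ j).snd
  have hξ : ‖ξ‖ ^ 2 = ‖x‖ ^ 2 + ‖y‖ ^ 2 := by
    rw [norm_copies_sq, norm_copies_sq, norm_copies_sq, ← Finset.sum_add_distrib]
    exact Finset.sum_congr rfl fun j _ => WithLp.prod_norm_sq_eq_of_L2 _
  have hrow : rowOp (couplingOp w) ξ = inFst HC HA (rowOp C.op x)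
      + inSnd HC HA (defectOp (adjoint (rowOp A.op)) (w (toDefect (rowOp C.op) x))
        + rowOp A.op y) := by
    have hx : toDefect (rowOp C.op) x = ∑ j, toDefect (rowOp C.op) (coord j (x j)) := by
      rw [← map_sum, sum_coord]
    rw [rowOp_apply, rowOp_apply, rowOp_apply, hx, map_sum, map_sum, Submodule.coe_sum, map_sum,
      ← Finset.sum_add_distrib, map_sum, ← Finset.sum_add_distrib]
    exact Finset.sum_congr rfl fun j _ => couplingOp_apply w j (ξ j)
  have hn : ∀ (a : HC) (b : HA), ‖inFst HC HA a + inSnd HC HA b‖ ^ 2 = ‖a‖ ^ 2 + ‖b‖ ^ 2 := by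
    intro a b
    rw [WithLp.prod_norm_sq_eq_of_L2]
    simp
  have h1 := A.norm_defectOp_add_le (w (toDefect (rowOp C.op) x)) y
  have h2 : ‖toDefect (rowOp C.op) x‖ ^ 2 = ‖x‖ ^ 2 - ‖rowOp C.op x‖ ^ 2 :=
    norm_defectOp_sq _ C.contractive x
  rw [LinearIsometry.norm_map, h2] at h1
  rw [← sq_le_sq₀ (norm_nonneg _) (norm_nonneg _), hrow, hn, hξ]
  linarith

/-- The row contraction `E = (C, 0; D_{*,A} w D_C, A)`. -/
def coupling (w : C.defect →ₗᵢ[ℂ] A.starDefect) : RowContraction d (WithLp 2 (HC × HA)) where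
  op := couplingOp w
  contractive := norm_rowOp_couplingOp_le w

theorem isLifting_coupling (w : C.defect →ₗᵢ[ℂ] A.starDefect) :
    IsLifting C A (coupling w) := by
  refine ⟨fun j => (defectOp (adjoint (rowOp A.op))).comp (A.starDefect.subtypeL.comp
        (w.toContinuousLinearMap.comp ((toDefect (rowOp C.op)).comp
          (coord j).toContinuousLinearMap))), fun j c a => ?_⟩
  exact inFst_add_inSnd (WithLp.toLp 2 (C.op j c, defectOp (adjoint (rowOp A.op))
    (w (toDefect (rowOp C.op) (coord j c))) + A.op j a))

theorem inner_coupling (w : C.defect →ₗᵢ[ℂ] A.starDefect) (j : Fin d) (c : HC) (a : HA) :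
    inner ℂ ((coupling w).op j (inFst HC HA c)) (inSnd HC HA a)
      = inner ℂ (w (toDefect (rowOp C.op) (coord j c)))
          (toDefect (adjoint (rowOp A.op)) a) := by
  rw [inner_inSnd_right, ← inner_defectOp_left]
  change inner ℂ (couplingOp w j (inFst HC HA c)).snd a = _
  rw [couplingOp_apply, WithLp.add_snd]
  simp

namespace IsLifting

variable {E : RowContraction d (WithLp 2 (HC × HA))} (h : IsLifting C A E)

/-- The hypothesis `hw` says `B = D_{*,A} w D_C`, in weak form. If `A` is completely non-coisometric,
such a lifting is minimal. -/
theorem isMinimalLifting_of_inner (h : IsLifting C A E) (hA : A.IsCNC)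
    {w : C.defect ≃ₗᵢ[ℂ] A.starDefect}
    (hw : ∀ j c a, inner ℂ (E.op j (inFst HC HA c)) (inSnd HC HA a)
      = inner ℂ (w (toDefect (rowOp C.op) (coord j c))) (toDefect (adjoint (rowOp A.op)) a)) :
    IsMinimalLifting E := by
  unfold IsMinimalLifting
  rw [Submodule.topologicalClosure_eq_top_iff, Submodule.eq_bot_iff]
  intro z hz
  have hz' : ∀ α c, inner ℂ (wordOp E.op α (inFst HC HA c)) z = 0 := fun α c =>
    (Submodule.mem_orthogonal _ _).1 hz _ (Submodule.subset_span ⟨α, c, rfl⟩)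
  have hfst : z.fst = 0 := by
    have h1 := hz' [] z.fst
    rwa [wordOp_nil, inner_inFst_left, inner_self_eq_zero] at h1
  have hzs : z = inSnd HC HA z.snd := by
    conv_lhs => rw [← inFst_add_inSnd z, hfst, map_zero, zero_add]
  -- The vectors of `H_A` that are orthogonal to all `E_α H_C`.
  let Z : Set HA := {a | ∀ α c, inner ℂ (wordOp E.op α (inFst HC HA c)) (inSnd HC HA a) = 0}
  have hB : ∀ a ∈ Z, ∀ j c, inner ℂ (E.op j (inFst HC HA c)) (inSnd HC HA a) = 0 := by
    intro a ha j c
    simpa [wordOp] using ha [j] c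
  have hsnd : z.snd = 0 := by
    refine hA.eq_zero Z ?_ ?_ (z := z.snd) (fun α c => by rw [← hzs]; exact hz' α c)
    · intro a ha j α c
      obtain ⟨y, hy⟩ : ∃ y, y = wordOp E.op α (inFst HC HA c) := ⟨_, rfl⟩
      have h1 : inner ℂ (E.op j y) (inSnd HC HA a) = 0 := by
        rw [hy, ← wordOp_cons]
        exact ha (j :: α) c
      rw [← inFst_add_inSnd y, map_add, inner_add_left, hB a ha, zero_add, h.op_inSnd,
        LinearIsometry.inner_map_map, ← adjoint_inner_right] at h1
      rw [← hy, inner_inSnd_right]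
      exact h1
    · intro a ha
      have h1 : ∀ δ, inner ℂ (w δ) (toDefect (adjoint (rowOp A.op)) a) = 0 := by
        refine fun δ => (denseRange_toDefect (rowOp C.op)).induction (P := fun δ =>
          inner ℂ (w δ) (toDefect (adjoint (rowOp A.op)) a) = 0) ?_
          (isClosed_eq (by fun_prop) (by fun_prop)) δ
        rintro _ ⟨x, rfl⟩
        rw [← sum_coord x, map_sum, map_sum, sum_inner]
        exact Finset.sum_eq_zero fun j _ => by rw [← hw, hB a ha]
      have h2 := h1 (w.symm (toDefect (adjoint (rowOp A.op)) a))
      rw [LinearIsometryEquiv.apply_symm_apply, inner_self_eq_zero] at h2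
      have h3 := norm_defectOp_sq _ A.norm_adjoint_rowOp_le a
      have h4 : ‖defectOp (adjoint (rowOp A.op)) a‖ = 0 := by
        rw [← norm_zero (E := A.starDefect), ← h2]
        rfl
      rw [h4] at h3
      linarith
  rw [hzs, hsnd, map_zero]

variable {K : Type*} [NormedAddCommGroup K] [InnerProductSpace ℂ K] [CompleteSpace K]
  (𝒟 : IsometricDilation E K)

/-- With `B = D_{*,A} w D_C`, the unitary `w` becomes the identification of `L_C` with
`L_{*,A}` inside the dilation space. -/
theorem overC_defectIso_eq (h𝒟 : 𝒟.IsMinimal) {w : C.defect →ₗᵢ[ℂ] A.starDefect}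
    (hw : ∀ j c a, inner ℂ (E.op j (inFst HC HA c)) (inSnd HC HA a)
      = inner ℂ (w (toDefect (rowOp C.op) (coord j c))) (toDefect (adjoint (rowOp A.op)) a))
    (δ : C.defect) : (h.overC 𝒟).defectIso δ = (h.overA 𝒟).starIso (w δ) := by
  have h1 : ∀ (c : HC) (j : Fin d) (a : HA),
      inner ℂ ((h.overC 𝒟).emb c) (𝒟.V j ((h.overA 𝒟).emb a)) = 0 := by
    intro c j a
    rw [h.inner_embC_V 𝒟 h𝒟, h.inner_embC_embA]
  have h2 : ∀ (i j : Fin d) (c : HC) (a : HA),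
      inner ℂ (𝒟.V i ((h.overC 𝒟).emb c)) (𝒟.V j ((h.overA 𝒟).emb a)) = 0 := by
    intro i j c a
    rw [𝒟.isRowIsometry i j, h.inner_embC_embA, ite_self]
  have h3 : ∀ (j : Fin d) (c : HC) (a : HA),
      inner ℂ (𝒟.V j ((h.overC 𝒟).emb c)) ((h.overA 𝒟).emb a)
        = inner ℂ (w (toDefect (rowOp C.op) (coord j c)))
            (toDefect (adjoint (rowOp A.op)) a) := by
    intro j c a
    rw [← hw, ← inner_conj_symm]
    refine Eq.trans ?_ (inner_conj_symm _ _)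
    exact congrArg _ (𝒟.inner_V_emb j (inFst HC HA c) (inSnd HC HA a))
  have key : ∀ δ η, inner ℂ ((h.overC 𝒟).defectIso δ) ((h.overA 𝒟).starIso η)
      = inner ℂ (w δ) η := by
    intro δ η
    refine (denseRange_toDefect (adjoint (rowOp A.op))).induction (P := fun η =>
      inner ℂ ((h.overC 𝒟).defectIso δ) ((h.overA 𝒟).starIso η) = inner ℂ (w δ) η) ?_
      (isClosed_eq (by fun_prop) (by fun_prop)) η
    rintro _ ⟨a, rfl⟩
    refine (denseRange_toDefect (rowOp C.op)).induction (P := fun δ =>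
      inner ℂ ((h.overC 𝒟).defectIso δ)
        ((h.overA 𝒟).starIso (toDefect (adjoint (rowOp A.op)) a))
        = inner ℂ (w δ) (toDefect (adjoint (rowOp A.op)) a)) ?_
      (isClosed_eq (by fun_prop) (by fun_prop)) δ
    rintro _ ⟨x, rfl⟩
    rw [← sum_coord x]
    simp only [map_sum, sum_inner]
    refine Finset.sum_congr rfl fun j _ => ?_
    have hc := (h.overC 𝒟).V_emb j (x j)
    rw [← sub_eq_iff_eq_add'] at hc
    rw [← hc, IsometricDilation.starIso_toDefect, inner_sub_left, inner_sub_right,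
      inner_sub_right, inner_sum, inner_sum, h.inner_embC_embA]
    refine Eq.trans ?_ (h3 j (x j) a)
    have e1 : ∀ i, inner ℂ ((h.overC 𝒟).V j ((h.overC 𝒟).emb (x j)))
        ((h.overA 𝒟).V i ((h.overA 𝒟).emb (adjoint (A.op i) a))) = 0 := fun i => h2 _ _ _ _
    have e2 : ∀ i, inner ℂ ((h.overC 𝒟).emb (C.op j (x j)))
        ((h.overA 𝒟).V i ((h.overA 𝒟).emb (adjoint (A.op i) a))) = 0 := fun i => h1 _ _ _
    simp only [e1, e2, Finset.sum_const_zero, sub_zero]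
    rfl
  -- Two isometries whose cross inner products are those of `w` agree along `w`.
  rw [← sub_eq_zero, ← norm_eq_zero, ← sq_eq_zero_iff, @norm_sub_sq ℂ, key,
    inner_self_eq_norm_sq, LinearIsometry.norm_map, LinearIsometry.norm_map,
    LinearIsometry.norm_map, LinearIsometry.norm_map]
  ring

/-- A lifting with `B = D_{*,A} w D_C` has `L_E = L_A` and `L_C = L_{*,A}`, in every minimal isometric
dilation of `E`. -/
theorem spaces_agree_of_inner (h𝒟 : 𝒟.IsMinimal) {w : C.defect ≃ₗᵢ[ℂ] A.starDefect}
    (hw : ∀ j c a, inner ℂ (E.op j (inFst HC HA c)) (inSnd HC HA a)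
      = inner ℂ (w (toDefect (rowOp C.op) (coord j c))) (toDefect (adjoint (rowOp A.op)) a)) :
    𝒟.wanderingSpace = (h.overA 𝒟).wanderingSpace ∧
      (h.overC 𝒟).wanderingSpace = (h.overA 𝒟).starWanderingSpace := by
  have hCA : ∀ δ, (h.overC 𝒟).defectIso δ = (h.overA 𝒟).starIso (w δ) :=
    h.overC_defectIso_eq 𝒟 h𝒟 (w := w.toLinearIsometry) hw
  constructor
  · refine h.wanderingSpace_eq_of_forall 𝒟 fun δ hδ => ?_
    -- A vector `k` of `L_E ⊖ L_A` is orthogonal to `V_j H_A` and to the space generated by `H_A`,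
    -- which contains `L_C`; so it is orthogonal to `V_j H_C` as well.
    have hV : ∀ j, ∀ y ∈ (h.spaceC 𝒟)ᗮ, inner ℂ (𝒟.V j y) (𝒟.defectIso δ) = 0 := fun j y hy =>
      inner_eq_zero_symm.1 (h.inner_defectIso_V_eq_zero 𝒟 h𝒟 hδ j hy)
    have hhull : ∀ y ∈ h.hullA 𝒟, inner ℂ y (𝒟.defectIso δ) = 0 := by
      refine fun y hy => inner_eq_zero_of_mem_invariantHull hy ?_
      rintro α _ ⟨a, rfl⟩
      cases α with
      | nil => rw [wordOp_nil]; exact 𝒟.inner_emb_defectIso (inSnd _ _ a) δ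
      | cons j α =>
        rw [wordOp_cons]
        exact hV j _ (h.hullA_le_spaceC_orthogonal 𝒟 (wordOp_mem_invariantHull α ⟨a, rfl⟩))
    have hVC : ∀ j c, inner ℂ (𝒟.V j ((h.overC 𝒟).emb c)) (𝒟.defectIso δ) = 0 := by
      intro j c
      have hc : 𝒟.V j ((h.overC 𝒟).emb c) = _ := (h.overC 𝒟).V_emb j c
      have h0 : inner ℂ ((h.overC 𝒟).emb (C.op j c)) (𝒟.defectIso δ) = 0 :=
        𝒟.inner_emb_defectIso (inFst _ _ (C.op j c)) δ
      rw [hc, inner_add_left, h0, zero_add, hCA]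
      exact hhull _ ((h.overA 𝒟).starIso_mem_hull _)
    have hVE : ∀ j x, inner ℂ (𝒟.V j (𝒟.emb x)) (𝒟.defectIso δ) = 0 := by
      intro j x
      rw [← h.embC_add_embA, map_add, inner_add_left, hVC, zero_add]
      exact hV j _ (h.hullA_le_spaceC_orthogonal 𝒟 ((h.overA 𝒟).emb_mem_hull _))
    have hall : ∀ η, inner ℂ (𝒟.defectIso η) (𝒟.defectIso δ) = 0 := by
      refine fun η => (denseRange_toDefect (rowOp E.op)).induction (P := fun η =>
        inner ℂ (𝒟.defectIso η) (𝒟.defectIso δ) = 0) ?_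
        (isClosed_eq (by fun_prop) (by fun_prop)) η
      rintro _ ⟨x, rfl⟩
      rw [IsometricDilation.defectIso_toDefect, inner_sub_left, sum_inner,
        𝒟.inner_emb_defectIso, sub_zero]
      exact Finset.sum_eq_zero fun j _ => hVE j _
    have h0 := hall δ
    rwa [LinearIsometry.inner_map_map, inner_self_eq_zero] at h0
  · rw [← IsometricDilation.range_defectIso, ← IsometricDilation.range_starIso]
    apply le_antisymm
    · rintro _ ⟨δ, rfl⟩
      exact ⟨w δ, (hCA δ).symm⟩
    · rintro _ ⟨η, rfl⟩
      exact ⟨w.symm η, (hCA _).trans (by rw [w.apply_symm_apply]; rfl)⟩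

theorem spacesAgree_of_inner {w : C.defect ≃ₗᵢ[ℂ] A.starDefect}
    (hw : ∀ j c a, inner ℂ (E.op j (inFst HC HA c)) (inSnd HC HA a)
      = inner ℂ (w (toDefect (rowOp C.op) (coord j c))) (toDefect (adjoint (rowOp A.op)) a)) :
    h.SpacesAgree := by
  rw [SpacesAgree, dilationC_eq, dilationA_eq]
  exact h.spaces_agree_of_inner E.dilation E.dilation_isMinimal hw

end IsLifting

end Construction

/-! ### The characteristic function as a complete unitary invariant -/

section Invariant

variable {d : ℕ} {H : Type*} {K : Type*} {H' : Type*} {K' : Type*}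
  [NormedAddCommGroup H] [InnerProductSpace ℂ H] [CompleteSpace H]
  [NormedAddCommGroup K] [InnerProductSpace ℂ K] [CompleteSpace K]
  [NormedAddCommGroup H'] [InnerProductSpace ℂ H'] [CompleteSpace H']
  [NormedAddCommGroup K'] [InnerProductSpace ℂ K'] [CompleteSpace K']
  {T : RowContraction d H} {T' : RowContraction d H'}

/-- The characteristic function is multi-analytic: it commutes with the creation operators. -/
theorem IsometricDilation.charFun_creation (𝒟 : IsometricDilation T K) (j : Fin d)
    (f : Fock d T.defect) :
    T.charFun (Fock.creation j f) = Fock.creation j (T.charFun f) := by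
  refine Fock.ext_inner_ket fun α δ => ?_
  rw [𝒟.inner_charFun, 𝒟.defectShift_creation]
  cases α with
  | nil =>
    rw [𝒟.starShift_ket, wordOp_nil, 𝒟.inner_starIso_V_of_mem_hull _ _ (𝒟.defectShift_mem_hull f)]
    exact ((Submodule.mem_orthogonal _ _).1
      (Fock.creation_mem_vacuum_orthogonal j (T.charFun f)) _ ⟨δ, rfl⟩).symm
  | cons i α =>
    rw [← Fock.creation_ket, 𝒟.starShift_creation, Fock.inner_creation, 𝒟.isRowIsometry i j,
      𝒟.inner_charFun]

/-- An operator that commutes with the creation operators is determined by its symbol. -/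
theorem map_ampliation_eq_of_symbol {D D' L L' : Type*}
    [NormedAddCommGroup D] [InnerProductSpace ℂ D] [CompleteSpace D]
    [NormedAddCommGroup D'] [InnerProductSpace ℂ D'] [CompleteSpace D']
    [NormedAddCommGroup L] [InnerProductSpace ℂ L] [CompleteSpace L]
    [NormedAddCommGroup L'] [InnerProductSpace ℂ L'] [CompleteSpace L']
    {M : Fock d D →L[ℂ] Fock d L} {M' : Fock d D' →L[ℂ] Fock d L'}
    {v : D →ₗᵢ[ℂ] D'} {v' : L →ₗᵢ[ℂ] L'}
    (hM : ∀ j f, M (Fock.creation j f) = Fock.creation j (M f))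
    (hM' : ∀ j f, M' (Fock.creation j f) = Fock.creation j (M' f))
    (hs : ∀ δ, symbol M' (v δ) = Fock.ampliation v' (symbol M δ)) (f : Fock d D) :
    M' (Fock.ampliation v f) = Fock.ampliation v' (M f) := by
  have : M'.comp (Fock.ampliation v).toContinuousLinearMap
      = (Fock.ampliation v').toContinuousLinearMap.comp M := by
    refine Fock.ext_ket fun α δ => ?_
    change M' (Fock.ampliation v (Fock.ket α δ)) = Fock.ampliation v' (M (Fock.ket α δ))
    induction α with
    | nil => rw [Fock.ampliation_ket]; exact hs δ
    | cons j α ih =>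
      rw [← Fock.creation_ket, Fock.ampliation_creation, hM', ih, hM, Fock.ampliation_creation]
  exact DFunLike.congr_fun this f

namespace IsometricDilation

/-- The map `(g, f) ↦ g + f` from `⨁_α V_α L_{*,T}` and `⨁_α V_α L_T` to the dilation space. -/
def shiftSum (𝒟 : IsometricDilation T K) : Fock d T.starDefect × Fock d T.defect →ₗ[ℂ] K :=
  𝒟.starShift.toLinearMap.coprod 𝒟.defectShift.toLinearMap

theorem shiftSum_apply (𝒟 : IsometricDilation T K) (x : Fock d T.starDefect × Fock d T.defect) :
    𝒟.shiftSum x = 𝒟.starShift x.1 + 𝒟.defectShift x.2 := rfl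

theorem mem_range_emb_iff {𝒟 : IsometricDilation T K} (h𝒟 : 𝒟.IsMinimal) {k : K} :
    k ∈ LinearMap.range 𝒟.emb.toLinearMap ↔ ∀ f, inner ℂ (𝒟.defectShift f) k = 0 := by
  constructor
  · rintro ⟨z, rfl⟩ f
    exact inner_eq_zero_symm.1 (𝒟.inner_emb_defectShift z f)
  · intro hk
    obtain ⟨z, f, rfl⟩ := 𝒟.exists_eq_of_mem_hull (h𝒟 k)
    have h1 := hk f
    rw [inner_add_right, inner_eq_zero_symm.1 (𝒟.inner_emb_defectShift z f), zero_add,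
      LinearIsometry.inner_map_map, inner_self_eq_zero] at h1
    rw [h1, map_zero, add_zero]
    exact ⟨z, rfl⟩

/-- For a completely non-coisometric `T`, the minimal dilation space is spanned by
`⨁_α V_α L_{*,T}` and `⨁_α V_α L_T`. -/
theorem denseRange_shiftSum {𝒟 : IsometricDilation T K} (h𝒟 : 𝒟.IsMinimal) (hT : T.IsCNC) :
    DenseRange 𝒟.shiftSum := by
  have hbot : (LinearMap.range 𝒟.shiftSum).topologicalClosure = ⊤ := by
    rw [Submodule.topologicalClosure_eq_top_iff, Submodule.eq_bot_iff]
    intro k hk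
    rw [Submodule.mem_orthogonal] at hk
    have hdef : ∀ f, inner ℂ (𝒟.defectShift f) k = 0 := fun f => by
      simpa [shiftSum_apply] using hk _ ⟨(0, f), rfl⟩
    have hstar : ∀ g, inner ℂ (𝒟.starShift g) k = 0 := fun g => by
      simpa [shiftSum_apply] using hk _ ⟨(g, 0), rfl⟩
    obtain ⟨z, rfl⟩ := (mem_range_emb_iff h𝒟).2 hdef
    let Z : Set H := {z | ∀ g, inner ℂ (𝒟.starShift g) (𝒟.emb z) = 0}
    have hz : z = 0 := by
      refine hT.eq_zero Z ?_ ?_ (z := z) hstar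
      · -- `V_j*` leaves `H` invariant and restricts to `T_j*` there.
        intro z hz j g
        obtain ⟨y, f, hy⟩ := 𝒟.exists_eq_of_mem_hull (h𝒟 (𝒟.starShift g))
        have h1 := hz (Fock.creation j g)
        rw [𝒟.starShift_creation, hy, map_add, ← 𝒟.defectShift_creation, inner_add_left,
          inner_eq_zero_symm.1 (𝒟.inner_emb_defectShift _ _), add_zero, inner_eq_zero_symm,
          𝒟.inner_V_emb, inner_eq_zero_symm, ← adjoint_inner_right] at h1
        rw [hy, inner_add_left, inner_eq_zero_symm.1 (𝒟.inner_emb_defectShift _ _), add_zero,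
          LinearIsometry.inner_map_map, h1]
      · intro z hz
        have h1 := hz (Fock.ket [] (toDefect (adjoint (rowOp T.op)) z))
        rw [𝒟.starShift_ket, wordOp_nil, inner_eq_zero_symm, 𝒟.inner_emb_starIso_toDefect,
          inner_self_eq_norm_sq_to_K, inner_self_eq_norm_sq_to_K, sub_eq_zero] at h1
        exact_mod_cast h1.symm
    rw [hz, map_zero]
  intro k
  have hk : k ∈ (LinearMap.range 𝒟.shiftSum).topologicalClosure := hbot ▸ trivial
  exact hk

theorem norm_shiftSum_sq (𝒟 : IsometricDilation T K)
    (x : Fock d T.starDefect × Fock d T.defect) :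
    ‖𝒟.shiftSum x‖ ^ 2
      = ‖x.1‖ ^ 2 + 2 * RCLike.re (inner ℂ x.1 (T.charFun x.2)) + ‖x.2‖ ^ 2 := by
  rw [shiftSum_apply, @norm_add_sq ℂ, ← 𝒟.inner_charFun, LinearIsometry.norm_map,
    LinearIsometry.norm_map]

theorem shiftSum_creation (𝒟 : IsometricDilation T K) (j : Fin d)
    (x : Fock d T.starDefect × Fock d T.defect) :
    𝒟.shiftSum (Fock.creation j x.1, Fock.creation j x.2) = 𝒟.V j (𝒟.shiftSum x) := by
  rw [shiftSum_apply, shiftSum_apply, map_add, starShift_creation, defectShift_creation]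

/-- Coinciding characteristic functions of completely non-coisometric row contractions give a
unitary between the minimal dilation spaces that intertwines the dilations and respects the
subspaces `⨁_α V_α L_T`. -/
theorem exists_unitary_of_coincide {𝒟 : IsometricDilation T K} {𝒟' : IsometricDilation T' K'}
    (h𝒟 : 𝒟.IsMinimal) (h𝒟' : 𝒟'.IsMinimal) (hT : T.IsCNC) (hT' : T'.IsCNC)
    (hc : Coincide T.charFun T'.charFun) :
    ∃ (Ψ : K ≃ₗᵢ[ℂ] K') (v : T.defect ≃ₗᵢ[ℂ] T'.defect), (∀ j k, Ψ (𝒟.V j k) = 𝒟'.V j (Ψ k)) ∧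
      ∀ f, Ψ (𝒟.defectShift f) = 𝒟'.defectShift (Fock.ampliation v.toLinearIsometry f) := by
  obtain ⟨v, v', hs⟩ := hc
  have hM := map_ampliation_eq_of_symbol (v := v.toLinearIsometry) 𝒟.charFun_creation
    𝒟'.charFun_creation hs
  let P : Fock d T.starDefect × Fock d T.defect →ₗ[ℂ] Fock d T'.starDefect × Fock d T'.defect :=
    LinearMap.prodMap (Fock.ampliation v'.toLinearIsometry).toLinearMap
      (Fock.ampliation v.toLinearIsometry).toLinearMap
  have hP : ∀ x, P x = (Fock.ampliation v'.toLinearIsometry x.1,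
    Fock.ampliation v.toLinearIsometry x.2) := fun _ => rfl
  have hPs : Function.Surjective P := by
    rintro ⟨g, f⟩
    obtain ⟨g, rfl⟩ := Fock.ampliation_surjective v' g
    obtain ⟨f, rfl⟩ := Fock.ampliation_surjective v f
    exact ⟨(g, f), rfl⟩
  have hd : DenseRange (𝒟'.shiftSum ∘ₗ P) := by
    have h1 := denseRange_shiftSum h𝒟' hT'
    unfold DenseRange at h1 ⊢
    rwa [LinearMap.coe_comp, hPs.range_comp]
  obtain ⟨Ψ, hΨ⟩ := exists_unitary_of_norm_eq 𝒟.shiftSum (𝒟'.shiftSum ∘ₗ P)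
    (denseRange_shiftSum h𝒟 hT) hd fun x => by
      rw [← sq_eq_sq₀ (norm_nonneg _) (norm_nonneg _), LinearMap.comp_apply, norm_shiftSum_sq,
        norm_shiftSum_sq, hP, hM, LinearIsometry.inner_map_map, LinearIsometry.norm_map,
        LinearIsometry.norm_map]
  refine ⟨Ψ, v, fun j k => ?_, fun f => ?_⟩
  · refine (denseRange_shiftSum h𝒟 hT).induction
      (P := fun k => Ψ (𝒟.V j k) = 𝒟'.V j (Ψ k)) ?_
      (isClosed_eq (by fun_prop) (by fun_prop)) k
    rintro _ ⟨x, rfl⟩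
    rw [← 𝒟.shiftSum_creation, hΨ, hΨ, LinearMap.comp_apply, LinearMap.comp_apply,
      ← 𝒟'.shiftSum_creation, hP, hP, Fock.ampliation_creation, Fock.ampliation_creation]
  · have h1 := hΨ (0, f)
    rw [LinearMap.comp_apply, hP, shiftSum_apply, shiftSum_apply, map_zero, map_zero, map_zero,
      zero_add, zero_add] at h1
    exact h1

theorem unitarilyEquivalent_of_coincide {𝒟 : IsometricDilation T K}
    {𝒟' : IsometricDilation T' K'} (h𝒟 : 𝒟.IsMinimal) (h𝒟' : 𝒟'.IsMinimal) (hT : T.IsCNC)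
    (hT' : T'.IsCNC) (hc : Coincide T.charFun T'.charFun) : T.UnitarilyEquivalent T' := by
  obtain ⟨Ψ, v, hΨV, hΨ⟩ := exists_unitary_of_coincide h𝒟 h𝒟' hT hT' hc
  have hmem : ∀ k, k ∈ LinearMap.range 𝒟.emb.toLinearMap ↔
      Ψ k ∈ LinearMap.range 𝒟'.emb.toLinearMap := by
    intro k
    rw [mem_range_emb_iff h𝒟, mem_range_emb_iff h𝒟',
      (Fock.ampliation_surjective (d := d) v).forall]
    simp only [← hΨ, LinearIsometryEquiv.inner_map_map]
  have hr : LinearMap.range (Ψ.toLinearIsometry.comp 𝒟.emb).toLinearMap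
      = LinearMap.range 𝒟'.emb.toLinearMap := by
    ext k
    constructor
    · rintro ⟨z, rfl⟩
      exact (hmem _).1 ⟨z, rfl⟩
    · intro hk
      obtain ⟨k, rfl⟩ := Ψ.surjective k
      obtain ⟨z, rfl⟩ := (hmem k).2 hk
      exact ⟨z, rfl⟩
  obtain ⟨u, hu⟩ := exists_unitary_of_range_eq _ _ hr
  replace hu : ∀ z, 𝒟'.emb (u z) = Ψ (𝒟.emb z) := hu
  refine ⟨u, fun j x => ext_inner_left ℂ fun y => ?_⟩
  have hdef : ∀ δ : T.defect, inner ℂ (𝒟'.emb y) (Ψ (𝒟.defectIso δ)) = 0 := by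
    intro δ
    have h1 : 𝒟.defectIso δ = 𝒟.defectShift (Fock.ket [] δ) := by
      rw [𝒟.defectShift_ket, wordOp_nil]
    rw [h1, hΨ, 𝒟'.inner_emb_defectShift]
  rw [← 𝒟'.inner_V_emb, hu, ← hΨV, 𝒟.V_emb, map_add, inner_add_right, hdef, add_zero, ← hu,
    LinearIsometry.inner_map_map]

/-- A unitary equivalence turns an isometric dilation of `T'` into one of `T`. -/
def pullback (𝒟' : IsometricDilation T' K') (u : H ≃ₗᵢ[ℂ] H')
    (hu : ∀ j x, u (T.op j x) = T'.op j (u x)) : IsometricDilation T K' where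
  V := 𝒟'.V
  emb := 𝒟'.emb.comp u.toLinearIsometry
  isRowIsometry := 𝒟'.isRowIsometry
  dilation := by
    have hw : ∀ α x, u (wordOp T.op α x) = wordOp T'.op α (u x) := by
      intro α x
      induction α with
      | nil => rw [wordOp_nil, wordOp_nil]
      | cons j α ih => rw [wordOp_cons, wordOp_cons, hu, ih]
    intro α x y
    refine (𝒟'.dilation α (u x) (u y)).trans ?_
    rw [← hw, LinearIsometryEquiv.inner_map_map]

theorem coincide_of_unitarilyEquivalent (𝒟' : IsometricDilation T' K')
    (h : T.UnitarilyEquivalent T') : Coincide T.charFun T'.charFun := by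
  obtain ⟨u, hu⟩ := h
  have hr : LinearMap.range (𝒟'.pullback u hu).emb.toLinearMap
      = LinearMap.range 𝒟'.emb.toLinearMap := by
    ext k
    constructor
    · rintro ⟨z, rfl⟩
      exact ⟨u z, rfl⟩
    · rintro ⟨z, rfl⟩
      refine ⟨u.symm z, ?_⟩
      change 𝒟'.emb (u (u.symm z)) = 𝒟'.emb z
      rw [u.apply_symm_apply]
  have h1 : (𝒟'.pullback u hu).wanderingSpace = 𝒟'.wanderingSpace := by
    unfold wanderingSpace
    rw [hr]
    rfl
  have h2 : (𝒟'.pullback u hu).starWanderingSpace = 𝒟'.starWanderingSpace := by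
    unfold starWanderingSpace
    rw [hr]
    rfl
  rw [← range_defectIso, ← range_defectIso] at h1
  rw [← range_starIso, ← range_starIso] at h2
  obtain ⟨v, hv⟩ := exists_unitary_of_range_eq _ _ h1
  obtain ⟨v', hv'⟩ := exists_unitary_of_range_eq _ _ h2
  refine ⟨v, v', fun δ => ?_⟩
  have hM := map_ampliation_eq_of_inner (v := v) (v' := v') (𝒟'.pullback u hu).inner_charFun
    𝒟'.inner_charFun (shiftEmb_ampliation _ _ _ _ _ v'.toLinearIsometry hv')
    (shiftEmb_ampliation _ _ _ _ _ v.toLinearIsometry hv) (Fock.ket [] δ)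
  rw [Fock.ampliation_ket] at hM
  exact hM

end IsometricDilation

end Invariant

end RowLift

end

theorem theorem4p5 {d : ℕ} {HC HA HA' : Type*}
    [NormedAddCommGroup HC] [InnerProductSpace ℂ HC] [CompleteSpace HC]
    [NormedAddCommGroup HA] [InnerProductSpace ℂ HA] [CompleteSpace HA]
    [NormedAddCommGroup HA'] [InnerProductSpace ℂ HA'] [CompleteSpace HA'] :
    (∀ (C : RowContraction d HC) (A : RowContraction d HA)
        (E : RowContraction d (WithLp 2 (HC × HA))) (h : IsLifting C A E), IsMinimalLifting E →
      ((IsPurelyContractive h.charFun ∧ SzegoCondition h.charFun) ↔ h.SpacesAgree) ∧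
      (h.SpacesAgree → h.CharFunEqPopescu)) ∧
    (∀ A : RowContraction d HA, A.IsCNC → ∀ C : RowContraction d HC,
      SameHilbertDim C.defect A.starDefect →
      ∃ (E : RowContraction d (WithLp 2 (HC × HA))) (h : IsLifting C A E),
        IsMinimalLifting E ∧ h.SpacesAgree ∧ h.CharFunEqPopescu) ∧
    (∀ (A : RowContraction d HA) (A' : RowContraction d HA'), A.IsCNC → A'.IsCNC →
      (Coincide A.charFun A'.charFun ↔ A.UnitarilyEquivalent A')) := by
  refine ⟨fun C A E h hmin => ⟨h.purelyContractive_and_szego_iff hmin,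
    fun hs => hs.charFunEqPopescu⟩, fun A hA C hdim => ?_, fun A A' hA hA' => ?_⟩
  · obtain ⟨w⟩ := hdim.exists_unitary
    have hw := inner_coupling (A := A) w.toLinearIsometry
    have h := isLifting_coupling (A := A) w.toLinearIsometry
    have hs := h.spacesAgree_of_inner hw
    exact ⟨_, h, h.isMinimalLifting_of_inner hA hw, hs, hs.charFunEqPopescu⟩
  · exact ⟨IsometricDilation.unitarilyEquivalent_of_coincide A.dilation_isMinimal
      A'.dilation_isMinimal hA hA', IsometricDilation.coincide_of_unitarilyEquivalent A'.dilation⟩
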